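/- Let $q\ge 4$ be a prime power. Let $V\subset\mathbb P^5(\mathbb F_q)$ be the image of $\mathbb P^2(\mathbb F_q)$ under the Veronese map $[x:y:z]\mapsto[x^2:xy:xz:y^2:yz:z^2]$, and let $G$ be a matrix over $\mathbb F_q$ with $6$ rows whose columns represent the points of $V$, each point exactly once, in any order and with any choice of representatives. Let $C_q$ be the linear code spanned by the rows of $G$ (the Veronese code). For integers $r\ge 1$ and $w\ge 0$ let $A_w^{(r)}$ be the number of $r$-dimensional linear subspaces $D\subseteq C_q$ of weight $w$, that is, such that exactly $w$ coordinate positions $i$ satisfy $c_i\neq 0$ for some $c\in D$. Then $C_q$ is a $[q^2+q+1,6]_q$ code, i.e. it has length $q^2+q+1$ and dimension $6$, and $$A_{q^2-q}^{(1)}=\tfrac{q^4+2q^3+2q^2+q}{2},\quad A_{q^2}^{(1)}=q^5+q+1,\quad A_{q^2+q}^{(1)}=\tfrac{q^4-q}{2},$$ $$A_{q^2-1}^{(2)}=q^4+q^3+q^2,\quad A_{q^2}^{(2)}=q^3+2q^2+2q+1,\quad A_{q^2+q-3}^{(2)}=\tfrac{q^8-q^6-q^5+q^3}{24},$$ $$A_{q^2+q-2}^{(2)}=\tfrac{q^7+q^6-q^4-q^3}{2},\quad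 A_{q^2+q-1}^{(2)}=\tfrac{q^8+5q^6+7q^5+4q^4-q^3-4q^2}{4},$$ $$A_{q^2+q}^{(2)}=\tfrac{2q^8+3q^7+q^6+4q^5+9q^4+5q^3-6q}{6},\quad A_{q^2+q+1}^{(2)}=\tfrac{3q^8+q^6-3q^5-q^3}{8},$$ $$A_{q^2}^{(3)}=q^2+q+1,\quad A_{q^2+q-2}^{(3)}=\tfrac{q^6+2q^5+2q^4+q^3}{6},\quad A_{q^2+q-1}^{(3)}=\tfrac{q^7+2q^6+3q^5+3q^4+2q^3+q^2}{2},$$ $$A_{q^2+q}^{(3)}=\tfrac{2q^8+2q^7+3q^6+2q^5+4q^4+3q^3+2q^2}{2},\quad A_{q^2+q+1}^{(3)}=\tfrac{6q^9+3q^7+2q^6+q^5-5q^4+2q^3-3q^2}{6},$$ $$A_{q^2+q-1}^{(4)}=\tfrac{q^4+2q^3+2q^2+q}{2},\quad A_{q^2+q}^{(4)}=q^6+2q^5+2q^4+q^3+q^2+q+1,\quad A_{q^2+q+1}^{(4)}=\tfrac{2q^8+2q^7+2q^6+q^4-q}{2},$$ $$A_{q^2+q}^{(5)}=q^2+q+1,\quad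 A_{q^2+q+1}^{(5)}=q^5+q^4+q^3,\quad A_{q^2+q+1}^{(6)}=1,$$ while $A_w^{(r)}=0$ for all other pairs $(r,w)$ with $r\ge 1$. -/

import Mathlib

open scoped LinearAlgebra.Projectivization

namespace Veronese

variable {F : Type*} [Field F]

/-- The vector of all monomials of degree two,
`(x, y, z) ↦ (x², xy, xz, y², yz, z²)`. -/
def monomials (v : Fin 3 → F) : Fin 6 → F :=
  ![v 0 ^ 2, v 0 * v 1, v 0 * v 2, v 1 ^ 2, v 1 * v 2, v 2 ^ 2]

theorem monomials_smul (a : F) (v : Fin 3 → F) :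
    monomials (a • v) = a ^ 2 • monomials v := by
  ext i
  fin_cases i <;> simp [monomials] <;> ring

theorem monomials_ne_zero {v : Fin 3 → F} (hv : v ≠ 0) : monomials v ≠ 0 := by
  intro h
  apply hv
  have h0 := congrFun h 0
  have h3 := congrFun h 3
  have h5 := congrFun h 5
  simp [monomials] at h0 h3 h5
  ext i
  fin_cases i <;> simp [h0, h3, h5]

/-- The Veronese map `ℙ² → ℙ⁵`, `[x : y : z] ↦ [x² : xy : xz : y² : yz : z²]`. -/
def veroneseMap : ℙ F (Fin 3 → F) → ℙ F (Fin 6 → F) :=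
  Projectivization.lift
    (fun v => Projectivization.mk F (monomials v.1) (monomials_ne_zero v.2)) (by
      rintro ⟨a, ha⟩ ⟨b, hb⟩ t h
      refine (Projectivization.mk_eq_mk_iff' F _ _ _ _).2 ⟨t ^ 2, ?_⟩
      change a = t • b at h
      change t ^ 2 • monomials b = monomials a
      rw [h, monomials_smul])

/-- `G` is a generator matrix of the Veronese code: its columns represent the points of the image
of the Veronese map, each point exactly once, in some order and with some choice of
representatives. -/
def IsVeroneseMatrix {n : ℕ} (G : Matrix (Fin 6) (Fin n) F) : Prop :=
  ∃ hG : ∀ j, G.col j ≠ 0,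
    Function.Injective (fun j => Projectivization.mk F (G.col j) (hG j)) ∧
      Set.range (fun j => Projectivization.mk F (G.col j) (hG j)) =
        Set.range (veroneseMap (F := F))

/-- The linear code generated by the rows of `G`. -/
def rowCode {k n : ℕ} (G : Matrix (Fin k) (Fin n) F) : Submodule F (Fin n → F) :=
  Submodule.span F (Set.range G.row)

/-- The support of a set of words: the union of the supports of its elements. -/
def codeSupport {n : ℕ} (T : Set (Fin n → F)) : Set (Fin n) :=
  ⋃ c ∈ T, {i | c i ≠ 0}

/-- The weight of a set of words: the number of elements of its support. -/
noncomputable def codeWeight {n : ℕ} (T : Set (Fin n → F)) : ℕ :=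
  (codeSupport T).ncard

/-- The higher weight spectrum `A_w^{(r)}` of the code `C`: the number of subcodes of `C` of
dimension `r` and weight `w`. -/
noncomputable def higherWeight {n : ℕ} (C : Submodule F (Fin n → F)) (r w : ℕ) : ℕ :=
  {D : Submodule F (Fin n → F) |
    D ≤ C ∧ Module.finrank F D = r ∧ codeWeight (D : Set (Fin n → F)) = w}.ncard

/-- The pairs `(r, w)` at which the higher weight spectrum of the Veronese code over the field
with `q ≥ 4` elements does not vanish (`q ^ 2 - q` is then an honest difference). -/
def exceptionalPairs (q : ℕ) : Set (ℕ × ℕ) :=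
  {(1, q ^ 2 - q), (1, q ^ 2), (1, q ^ 2 + q),
   (2, q ^ 2 - 1), (2, q ^ 2), (2, q ^ 2 + q - 3), (2, q ^ 2 + q - 2), (2, q ^ 2 + q - 1),
   (2, q ^ 2 + q), (2, q ^ 2 + q + 1),
   (3, q ^ 2), (3, q ^ 2 + q - 2), (3, q ^ 2 + q - 1), (3, q ^ 2 + q), (3, q ^ 2 + q + 1),
   (4, q ^ 2 + q - 1), (4, q ^ 2 + q), (4, q ^ 2 + q + 1),
   (5, q ^ 2 + q), (5, q ^ 2 + q + 1),
   (6, q ^ 2 + q + 1)}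

end Veronese

/-! A codeword is the list of values, up to nonzero scalars, of a quadratic form at the points of
the plane. Hence `r`-dimensional subcodes are `r`-dimensional linear systems of conics, and the
weight is `q ^ 2 + q + 1` minus the number of common rational zeros. It remains to find the number
N(r, k) of systems with exactly `k` common zeros.

Double counting pairs (system, `j`-set of common zeros) gives the moment equations: the sum over `k`
of N(r, k) times `k.choose j` equals the number of `r`-dimensional systems through `S`, summed over
all `j`-sets `S` (`sum_choose_card_zeros`). At most five points, no four of them collinear, impose
independent conditions on conics (`finrank_vanishingForms`), so the right side is explicit for `j ≤
3`. For `j = 4` only collinear quadruples need a correction.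

Few values of `k` can occur. For `r = 1` they are 0, 1, `q + 1`, `2 q + 1`, and four moments
suffice. For `r = 2` five zeros, and for `r = 3` four zeros, force a common line component
(`le_lineForms_of_five_le_card`, `eq_lineForms_of_four_le_card`). Such systems are counted directly,
and the rest follows from a triangular system. For `r ≥ 4` there are at most `6 - r` zeros. -/

namespace Veronese

/-! ### Counting subspaces over a finite field. -/

section Subspaces

variable {K V : Type*} [Field K] [AddCommGroup V] [Module K V]

/-- The second components live in types depending on the subspace; comparing their vectors in `V`
avoids transport along an equality of subspaces. -/
theorem sigma_linearIndependent_ext {r : ℕ}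
    {t t' : Σ D : {D : Submodule K V // Module.finrank K D = r},
      {s : Fin r → D.1 // LinearIndependent K s}}
    (h : t.1.1 = t'.1.1) (h' : ∀ i, (t.2.1 i : V) = t'.2.1 i) : t = t' := by
  obtain ⟨⟨D, hD⟩, ⟨s, hs⟩⟩ := t
  obtain ⟨⟨D', hD'⟩, ⟨s', hs'⟩⟩ := t'
  obtain rfl : D = D' := h
  obtain rfl : s = s' := funext fun i => Subtype.ext (h' i)
  rfl

/-- A linearly independent family is the same as its span together with a linearly independent
family in the span. -/
noncomputable def linearIndependentEquivSigma [FiniteDimensional K V] (r : ℕ) :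
    {s : Fin r → V // LinearIndependent K s} ≃
      Σ D : {D : Submodule K V // Module.finrank K D = r},
        {s : Fin r → D.1 // LinearIndependent K s} where
  toFun s := ⟨⟨Submodule.span K (Set.range s.1), by simpa using finrank_span_eq_card s.2⟩,
    ⟨fun i => ⟨s.1 i, Submodule.subset_span ⟨i, rfl⟩⟩, linearIndependent_span s.2⟩⟩
  invFun t := ⟨fun i => (t.2.1 i : V),
    t.2.2.map' t.1.1.subtype (Submodule.ker_subtype _)⟩
  left_inv s := rfl
  right_inv := by
    rintro ⟨⟨D, hD⟩, ⟨s, hs⟩⟩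
    have key : Submodule.span K (Set.range fun i => (s i : V)) = D := by
      refine Submodule.eq_of_le_of_finrank_eq ?_ ?_
      · rw [Submodule.span_le]
        rintro _ ⟨i, rfl⟩
        exact (s i).2
      · rw [hD]
        exact (finrank_span_eq_card (hs.map' D.subtype (Submodule.ker_subtype _))).trans
          (Fintype.card_fin r)
    exact sigma_linearIndependent_ext key fun i => rfl

/-- Each independent `r`-tuple is an ordered basis of exactly one `r`-dimensional subspace, and all
these subspaces have equally many ordered bases. -/
theorem card_subspaces_mul [Fintype K] [Finite V] {r : ℕ} (hr : r ≤ Module.finrank K V) :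
    Nat.card {D : Submodule K V // Module.finrank K D = r} *
        ∏ i : Fin r, (Fintype.card K ^ r - Fintype.card K ^ i.val) =
      ∏ i : Fin r, (Fintype.card K ^ Module.finrank K V - Fintype.card K ^ i.val) := by
  classical
  rw [← card_linearIndependent hr, Nat.card_congr (linearIndependentEquivSigma r)]
  have : Fintype {D : Submodule K V // Module.finrank K D = r} := Fintype.ofFinite _
  rw [Nat.card_sigma, Finset.sum_congr rfl (g := fun _ =>
    ∏ i : Fin r, (Fintype.card K ^ r - Fintype.card K ^ i.val)), Finset.sum_const,
    Finset.card_univ, Nat.card_eq_fintype_card, smul_eq_mul]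
  rintro ⟨D, hD⟩ -
  rw [card_linearIndependent hD.ge, hD]

open scoped Classical in
/-- The number of `r`-dimensional subspaces of a subspace `W`, without division. -/
theorem card_subspaces_le_mul [Fintype K] [Finite V] [Fintype (Submodule K V)]
    (W : Submodule K V) {r m : ℕ} (hW : Module.finrank K W = m) (hr : r ≤ m) :
    ((Finset.univ.filter fun D : Submodule K V => D ≤ W ∧ Module.finrank K D = r).card : ℚ) *
        ∏ i : Fin r, ((Fintype.card K : ℚ) ^ r - (Fintype.card K : ℚ) ^ i.val) =
      ∏ i : Fin r, ((Fintype.card K : ℚ) ^ m - (Fintype.card K : ℚ) ^ i.val) := by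
  subst hW
  have h := card_subspaces_mul (K := K) (V := W) hr
  have e : {D : Submodule K W // Module.finrank K D = r} ≃
      {D : Submodule K V // D ≤ W ∧ Module.finrank K D = r} :=
    { toFun := fun D => ⟨D.1.map W.subtype, Submodule.map_subtype_le W D.1, 
        (Submodule.finrank_map_subtype_eq W D.1).trans D.2⟩
      invFun := fun D => ⟨D.1.comap W.subtype, 
        (Submodule.comapSubtypeEquivOfLe D.2.1).finrank_eq.trans D.2.2⟩
      left_inv := fun D => Subtype.ext
        (Submodule.comap_map_eq_of_injective (Submodule.subtype_injective W) D.1)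
      right_inv := fun D => Subtype.ext (by
        simpa [Submodule.map_comap_subtype] using D.2.1) }
  rw [Nat.card_congr e, Nat.card_eq_fintype_card, Fintype.card_subtype] at h
  have hq : 1 ≤ Fintype.card K := Fintype.card_pos
  have h' := congrArg (Nat.cast : ℕ → ℚ) h
  push_cast at h'
  rw [Finset.prod_congr rfl fun i _ => Nat.cast_sub (Nat.pow_le_pow_right hq i.2.le),
    Finset.prod_congr rfl fun i _ =>
      Nat.cast_sub (Nat.pow_le_pow_right hq (i.2.le.trans hr))] at h'
  push_cast at h'
  exact h'

end Subspaces

end Veronese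

namespace Veronese

open Configuration Configuration.ofField Matrix

/-- The projective plane over a field; its elements serve both as points and as lines. -/
abbrev Plane (F : Type*) [Field F] := ℙ F (Fin 3 → F)

/-! ### Points and lines of the projective plane. -/

section Incidence

variable {F : Type*} [Field F]

theorem mem_iff_dotProduct (P l : Plane F) : P ∈ l ↔ P.rep ⬝ᵥ l.rep = 0 := by
  conv_lhs => rw [← P.mk_rep, ← l.mk_rep]
  exact Projectivization.orthogonal_mk _ _

theorem mk_mem_iff {v : Fin 3 → F} (hv : v ≠ 0) (l : Plane F) :
    Projectivization.mk F v hv ∈ l ↔ v ⬝ᵥ l.rep = 0 := by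
  conv_lhs => rw [← l.mk_rep]
  exact Projectivization.orthogonal_mk _ _

theorem mem_mk_iff {v : Fin 3 → F} (hv : v ≠ 0) (P : Plane F) :
    P ∈ Projectivization.mk F v hv ↔ P.rep ⬝ᵥ v = 0 := by
  conv_lhs => rw [← P.mk_rep]
  exact Projectivization.orthogonal_mk _ _

theorem line_unique {P Q l m : Plane F} (hPQ : P ≠ Q) (hPl : P ∈ l) (hQl : Q ∈ l) (hPm : P ∈ m)
    (hQm : Q ∈ m) : l = m :=
  (Nondegenerate.eq_or_eq hPl hQl hPm hQm).resolve_left hPQ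

theorem exists_line {P Q : Plane F} (h : P ≠ Q) : ∃ l : Plane F, P ∈ l ∧ Q ∈ l := by
  classical
  exact ⟨HasLines.mkLine h, HasLines.mkLine_ax h⟩

theorem exists_point {l m : Plane F} (h : l ≠ m) : ∃ P : Plane F, P ∈ l ∧ P ∈ m := by
  classical
  exact ⟨HasPoints.mkPoint h, HasPoints.mkPoint_ax h⟩

/-- Join `A` to a point `Q` off the line `AP`. -/
theorem exists_line_notMem {A P : Plane F} (h : A ≠ P) : ∃ l : Plane F, A ∈ l ∧ P ∉ l := by
  obtain ⟨l, hAl, hPl⟩ := exists_line h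
  obtain ⟨Q, hQ⟩ := Nondegenerate.exists_point (P := Plane F) l
  have hAQ : A ≠ Q := fun h => hQ (h ▸ hAl)
  obtain ⟨m, hAm, hQm⟩ := exists_line hAQ
  exact ⟨m, hAm, fun hPm => hQ (line_unique h hAl hPl hAm hPm ▸ hQm)⟩

/-- If no line through `A` and `B` avoids `P`, then `B` lies on the line `AP`. -/
theorem mem_line_of_forall {A B P l : Plane F} (h : A ≠ P)
    (hno : ¬ ∃ m : Plane F, (A ∈ m ∧ B ∈ m) ∧ P ∉ m) (hA : A ∈ l) (hP : P ∈ l) : B ∈ l := by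
  by_contra hB
  have hAB : A ≠ B := fun h => hB (h ▸ hA)
  obtain ⟨m, hAm, hBm⟩ := exists_line hAB
  refine hno ⟨m, ⟨hAm, hBm⟩, fun hPm => hB ?_⟩
  exact line_unique h hA hP hAm hPm ▸ hBm

section Finite

variable [Fintype (Plane F)]

theorem card_plane [Fintype F] :
    Fintype.card (Plane F) = Fintype.card F ^ 2 + Fintype.card F + 1 := by
  have h := Projectivization.card_of_finrank F (Fin 3 → F) (n := 3) (by simp)
  rw [Nat.card_eq_fintype_card, Nat.card_eq_fintype_card] at h
  simp [h, Finset.sum_range_succ]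
  ring

theorem plane_order [Fintype F] [DecidableEq F] :
    ProjectivePlane.order (Plane F) (Plane F) = Fintype.card F := by
  have h := ProjectivePlane.card_points (Plane F) (Plane F)
  rw [card_plane] at h
  nlinarith [h]

open scoped Classical in
/-- The points of a line. -/
noncomputable def linePoints (l : Plane F) : Finset (Plane F) := Finset.univ.filter fun P => P ∈ l

@[simp] theorem mem_linePoints {P l : Plane F} : P ∈ linePoints l ↔ P ∈ l := by
  simp [linePoints]

theorem card_linePoints [Fintype F] (l : Plane F) : (linePoints l).card = Fintype.card F + 1 := by
  classical
  have h := ProjectivePlane.pointCount_eq (Plane F) (L := Plane F) l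
  rw [plane_order, pointCount, Nat.card_eq_fintype_card, Fintype.card_subtype] at h
  rw [← h]
  exact congrArg Finset.card (by ext; simp)

open scoped Classical in
/-- The lines through a point. -/
noncomputable def pencil (P : Plane F) : Finset (Plane F) := Finset.univ.filter fun l => P ∈ l

@[simp] theorem mem_pencil {P l : Plane F} : l ∈ pencil P ↔ P ∈ l := by
  simp [pencil]

theorem card_pencil [Fintype F] (P : Plane F) : (pencil P).card = Fintype.card F + 1 := by
  classical
  have h := ProjectivePlane.lineCount_eq (Plane F) (P := Plane F) P
  rw [plane_order, lineCount, Nat.card_eq_fintype_card, Fintype.card_subtype] at h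
  rw [← h]
  exact congrArg Finset.card (by ext; simp)

end Finite

end Incidence

/-! ### Conditions imposed by points on quadratic forms. -/

section Forms

variable {F : Type*} [Field F]

theorem dotProduct_monomials_smul (c : Fin 6 → F) (a : F) (v : Fin 3 → F) :
    c ⬝ᵥ monomials (a • v) = a ^ 2 * (c ⬝ᵥ monomials v) := by
  rw [monomials_smul, dotProduct_smul, smul_eq_mul]

theorem dotProduct_monomials_mk_rep (c : Fin 6 → F) {v : Fin 3 → F} (hv : v ≠ 0) :
    c ⬝ᵥ monomials (Projectivization.mk F v hv).rep = 0 ↔ c ⬝ᵥ monomials v = 0 := by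
  obtain ⟨a, ha⟩ := Projectivization.exists_smul_eq_mk_rep F v hv
  rw [← ha, Units.smul_def, dotProduct_monomials_smul]
  simp

/-- The coefficients of the product of two linear forms. -/
def mulForm (a : Fin 3 → F) : (Fin 3 → F) →ₗ[F] (Fin 6 → F) where
  toFun b := ![a 0 * b 0, a 0 * b 1 + a 1 * b 0, a 0 * b 2 + a 2 * b 0, a 1 * b 1,
    a 1 * b 2 + a 2 * b 1, a 2 * b 2]
  map_add' b c := by
    ext i
    fin_cases i <;> simp <;> ring
  map_smul' t b := by
    ext i
    fin_cases i <;> simp <;> ring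

theorem mulForm_dotProduct_monomials (a b v : Fin 3 → F) :
    mulForm a b ⬝ᵥ monomials v = (v ⬝ᵥ a) * (v ⬝ᵥ b) := by
  simp [mulForm, monomials, dotProduct, Fin.sum_univ_succ]
  ring

/-- Polynomials have no zero divisors. On coefficients: a nonzero coordinate of `a` kills the
coordinates of `b` in turn. -/
theorem mulForm_injective {a : Fin 3 → F} (ha : a ≠ 0) : Function.Injective (mulForm a) := by
  rw [injective_iff_map_eq_zero]
  intro b hb
  have h0 : a 0 * b 0 = 0 := congrFun hb 0
  have h1 : a 0 * b 1 + a 1 * b 0 = 0 := congrFun hb 1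
  have h2 : a 0 * b 2 + a 2 * b 0 = 0 := congrFun hb 2
  have h3 : a 1 * b 1 = 0 := congrFun hb 3
  have h4 : a 1 * b 2 + a 2 * b 1 = 0 := congrFun hb 4
  have h5 : a 2 * b 2 = 0 := congrFun hb 5
  have : a 0 ≠ 0 ∨ a 1 ≠ 0 ∨ a 2 ≠ 0 := by
    by_contra! h
    exact ha (by ext i; fin_cases i <;> simp [h])
  have hb' : b 0 = 0 ∧ b 1 = 0 ∧ b 2 = 0 := by grind
  ext i
  fin_cases i <;> simp [hb']

/-- The quadratic forms vanishing at all points of a set. -/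
def vanishingForms (S : Set (Plane F)) : Submodule F (Fin 6 → F) where
  carrier := {c | ∀ P ∈ S, c ⬝ᵥ monomials P.rep = 0}
  add_mem' ha hb P hP := by rw [add_dotProduct, ha P hP, hb P hP, add_zero]
  zero_mem' P _ := zero_dotProduct _
  smul_mem' t c hc P hP := by rw [smul_dotProduct, hc P hP, smul_zero]

theorem mem_vanishingForms {S : Set (Plane F)} {c : Fin 6 → F} :
    c ∈ vanishingForms S ↔ ∀ P ∈ S, c ⬝ᵥ monomials P.rep = 0 := Iff.rfl

theorem vanishingForms_anti {S T : Set (Plane F)} (h : S ⊆ T) :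
    vanishingForms T ≤ vanishingForms S := fun _ hc P hP => hc P (h hP)

/-- The separating forms, rescaled, map to the standard basis under evaluation at `S`, so evaluation
is surjective and rank-nullity gives its kernel. -/
theorem finrank_vanishingForms_of_separated (S : Finset (Plane F))
    (h : ∀ P ∈ S, ∃ c : Fin 6 → F, (∀ Q ∈ S, Q ≠ P → c ⬝ᵥ monomials Q.rep = 0) ∧
      c ⬝ᵥ monomials P.rep ≠ 0) :
    Module.finrank F (vanishingForms (S : Set (Plane F))) + S.card = 6 := by
  classical
  let φ : (Fin 6 → F) →ₗ[F] (S → F) :=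
    { toFun := fun c P => c ⬝ᵥ monomials P.1.rep
      map_add' := fun a b => by ext; simp [add_dotProduct]
      map_smul' := fun t a => by ext; simp [smul_dotProduct] }
  have hker : LinearMap.ker φ = vanishingForms (S : Set (Plane F)) := by
    ext c
    rw [LinearMap.mem_ker, mem_vanishingForms]
    exact ⟨fun hc P hP => congrFun hc ⟨P, hP⟩, fun hc => funext fun P => hc P.1 P.2⟩
  have hrange : LinearMap.range φ = ⊤ := by
    rw [eq_top_iff, ← (Pi.basisFun F S).span_eq, Submodule.span_le]
    rintro _ ⟨P, rfl⟩
    obtain ⟨c, hc, hcP⟩ := h P.1 P.2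
    refine ⟨(c ⬝ᵥ monomials P.1.rep)⁻¹ • c, ?_⟩
    ext Q
    rw [map_smul, Pi.smul_apply, Pi.basisFun_apply]
    by_cases hQ : Q = P
    · subst hQ
      simp [φ, hcP]
    · rw [Pi.single_eq_of_ne hQ]
      simp [φ, hc Q.1 Q.2 fun h => hQ (Subtype.ext h)]
  have := LinearMap.finrank_range_add_finrank_ker φ
  rw [hker, hrange, finrank_top] at this
  simp at this
  omega

/-- A product of two lines through four points and avoiding a fifth one. -/
theorem exists_form_separating {A B C D P : Plane F}
    (h₁ : ∃ m : Plane F, (A ∈ m ∧ B ∈ m) ∧ P ∉ m) (h₂ : ∃ m : Plane F, (C ∈ m ∧ D ∈ m) ∧ P ∉ m)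
    (S : Finset (Plane F)) (hS : ∀ Q ∈ S, Q ≠ P → Q = A ∨ Q = B ∨ Q = C ∨ Q = D) :
    ∃ c : Fin 6 → F, (∀ Q ∈ S, Q ≠ P → c ⬝ᵥ monomials Q.rep = 0) ∧
      c ⬝ᵥ monomials P.rep ≠ 0 := by
  obtain ⟨l, ⟨hA, hB⟩, hl⟩ := h₁
  obtain ⟨m, ⟨hC, hD⟩, hm⟩ := h₂
  rw [mem_iff_dotProduct] at *
  refine ⟨mulForm l.rep m.rep, fun Q hQ hQP => ?_, ?_⟩
  · rw [mulForm_dotProduct_monomials]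
    rcases hS Q hQ hQP with rfl | rfl | rfl | rfl <;> simp [*]
  · rw [mulForm_dotProduct_monomials]
    exact mul_ne_zero hl hm

/-- Each `P` is separated from the other points, at most four, by a pair of lines covering them and
missing `P`. If no pairing of the others works, `P` is collinear with three of them. -/
theorem finrank_vanishingForms (S : Finset (Plane F)) (hcard : S.card ≤ 5)
    (hS : ∀ T ⊆ S, T.card = 4 → ¬ ∃ l : Plane F, ∀ P ∈ T, P ∈ l) :
    Module.finrank F (vanishingForms (S : Set (Plane F))) + S.card = 6 := by
  classical
  refine finrank_vanishingForms_of_separated S fun P hP => ?_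
  have hE : (S.erase P).card ≤ 4 := by rw [Finset.card_erase_of_mem hP]; omega
  have hmem : ∀ {Q}, Q ∈ S.erase P → Q ∈ S ∧ Q ≠ P := fun h =>
    ⟨Finset.mem_of_mem_erase h, Finset.ne_of_mem_erase h⟩
  -- Repeating `A` fits a single point into the format of `exists_form_separating`.
  have single : ∀ {A : Plane F}, A ≠ P → ∃ m : Plane F, (A ∈ m ∧ A ∈ m) ∧ P ∉ m := fun h => by
    obtain ⟨l, h1, h2⟩ := exists_line_notMem h
    exact ⟨l, ⟨h1, h1⟩, h2⟩
  have swap : ∀ {A B : Plane F}, (¬ ∃ m : Plane F, (A ∈ m ∧ B ∈ m) ∧ P ∉ m) →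
      ¬ ∃ m : Plane F, (B ∈ m ∧ A ∈ m) ∧ P ∉ m := fun h ⟨m, h1, h2⟩ => h ⟨m, h1.symm, h2⟩
  -- Two bad pairs sharing `X` put `Y` and `Z` on the line `XP`: four collinear points.
  have pivot : ∀ {X Y Z : Plane F}, X ∈ S.erase P → Y ∈ S.erase P → Z ∈ S.erase P → X ≠ Y → X ≠ Z →
      Y ≠ Z → (¬ ∃ m : Plane F, (X ∈ m ∧ Y ∈ m) ∧ P ∉ m) →
      (¬ ∃ m : Plane F, (X ∈ m ∧ Z ∈ m) ∧ P ∉ m) → False := by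
    intro X Y Z hX hY hZ hXY hXZ hYZ h1 h2
    obtain ⟨hXS, hXP⟩ := hmem hX
    obtain ⟨hYS, hYP⟩ := hmem hY
    obtain ⟨hZS, hZP⟩ := hmem hZ
    obtain ⟨l, hXl, hPl⟩ := exists_line hXP
    refine hS {P, X, Y, Z} ?_ ?_ ⟨l, ?_⟩
    · intro Q hQ
      simp only [Finset.mem_insert, Finset.mem_singleton] at hQ
      rcases hQ with rfl | rfl | rfl | rfl <;> assumption
    · simp [Finset.card_insert_of_notMem, hXY, hXZ, hYZ, Ne.symm hXP, Ne.symm hYP, Ne.symm hZP]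
    · intro Q hQ
      simp only [Finset.mem_insert, Finset.mem_singleton] at hQ
      rcases hQ with rfl | rfl | rfl | rfl
      · exact hPl
      · exact hXl
      · exact mem_line_of_forall hXP h1 hXl hPl
      · exact mem_line_of_forall hXP h2 hXl hPl
  have cover : ∀ {Q}, Q ∈ S → Q ≠ P → Q ∈ S.erase P := fun h h' => Finset.mem_erase.2 ⟨h', h⟩
  obtain h0 | h1 | h2 | h3 | h4 : (S.erase P).card = 0 ∨ (S.erase P).card = 1 ∨
      (S.erase P).card = 2 ∨ (S.erase P).card = 3 ∨ (S.erase P).card = 4 := by omega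
  · obtain ⟨l, hl⟩ := Nondegenerate.exists_line (L := Plane F) P
    rw [mem_iff_dotProduct] at hl
    refine ⟨mulForm l.rep l.rep, fun Q hQ hQP => ?_, ?_⟩
    · have := cover hQ hQP
      rw [Finset.card_eq_zero.1 h0] at this
      simp at this
    · rw [mulForm_dotProduct_monomials]
      exact mul_ne_zero hl hl
  · obtain ⟨A, hA⟩ := Finset.card_eq_one.1 h1
    have hAP : A ≠ P := (hmem (hA ▸ Finset.mem_singleton_self A)).2
    refine exists_form_separating (single hAP) (single hAP) S fun Q hQ hQP => ?_
    have := cover hQ hQP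
    rw [hA] at this
    simp at this
    tauto
  · obtain ⟨A, B, hAB, hE⟩ := Finset.card_eq_two.1 h2
    have hAP : A ≠ P := (hmem (by rw [hE]; simp)).2
    have hBP : B ≠ P := (hmem (by rw [hE]; simp)).2
    refine exists_form_separating (single hAP) (single hBP) S fun Q hQ hQP => ?_
    have := cover hQ hQP
    rw [hE] at this
    simp at this
    tauto
  · obtain ⟨A, B, C, hAB, hAC, hBC, hE⟩ := Finset.card_eq_three.1 h3
    have hA : A ∈ S.erase P := by rw [hE]; simp
    have hB : B ∈ S.erase P := by rw [hE]; simp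
    have hC : C ∈ S.erase P := by rw [hE]; simp
    have hcov : ∀ Q ∈ S, Q ≠ P → Q = A ∨ Q = B ∨ Q = C := fun Q hQ hQP => by
      have := cover hQ hQP
      rw [hE] at this
      simpa using this
    by_cases h1 : ∃ m : Plane F, (A ∈ m ∧ B ∈ m) ∧ P ∉ m
    · exact exists_form_separating h1 (single (hmem hC).2) S fun Q hQ hQP => by
        have := hcov Q hQ hQP; tauto
    by_cases h2 : ∃ m : Plane F, (A ∈ m ∧ C ∈ m) ∧ P ∉ m
    · exact exists_form_separating h2 (single (hmem hB).2) S fun Q hQ hQP => by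
        have := hcov Q hQ hQP; tauto
    exact (pivot hA hB hC hAB hAC hBC h1 h2).elim
  · obtain ⟨A, E, hAE, hE', hE3⟩ := Finset.card_eq_succ.1 h4
    obtain ⟨B, C, D, hBC, hBD, hCD, rfl⟩ := Finset.card_eq_three.1 hE3
    have hE := hE'.symm
    have hA : A ∈ S.erase P := by rw [hE]; simp
    have hB : B ∈ S.erase P := by rw [hE]; simp
    have hC : C ∈ S.erase P := by rw [hE]; simp
    have hD : D ∈ S.erase P := by rw [hE]; simp
    simp only [Finset.mem_insert, Finset.mem_singleton, not_or] at hAE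
    obtain ⟨hAB, hAC, hAD⟩ := hAE
    have hcov : ∀ Q ∈ S, Q ≠ P → Q = A ∨ Q = B ∨ Q = C ∨ Q = D := fun Q hQ hQP => by
      have := cover hQ hQP
      rw [hE] at this
      simpa using this
    by_cases h1 : (∃ m : Plane F, (A ∈ m ∧ B ∈ m) ∧ P ∉ m) ∧ ∃ m : Plane F, (C ∈ m ∧ D ∈ m) ∧ P ∉ m
    · exact exists_form_separating h1.1 h1.2 S hcov
    by_cases h2 : (∃ m : Plane F, (A ∈ m ∧ C ∈ m) ∧ P ∉ m) ∧ ∃ m : Plane F, (B ∈ m ∧ D ∈ m) ∧ P ∉ m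
    · exact exists_form_separating h2.1 h2.2 S fun Q hQ hQP => by
        have := hcov Q hQ hQP; tauto
    -- A bad pair from `AB|CD` and a bad pair from `AC|BD` always share exactly one point, which
    -- serves as pivot.
    exfalso
    rw [not_and_or] at h1 h2
    rcases h1 with h1 | h1 <;> rcases h2 with h2 | h2
    · exact pivot hA hB hC hAB hAC hBC h1 h2
    · exact pivot hB hA hD (Ne.symm hAB) hBD hAD (swap h1) h2
    · exact pivot hC hD hA hCD (Ne.symm hAC) (Ne.symm hAD) h1 (swap h2)
    · exact pivot hD hC hB (Ne.symm hCD) (Ne.symm hBD) (Ne.symm hBC) (swap h1) (swap h2)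

/-- The quadratic forms vanishing on a line are the multiples of its equation. -/
theorem vanishingForms_eq_range {l : Plane F} {S : Set (Plane F)} (hSl : ∀ P ∈ S, P ∈ l)
    {T : Finset (Plane F)} (hT : T.card = 3) (hTS : (T : Set (Plane F)) ⊆ S) :
    vanishingForms S = LinearMap.range (mulForm l.rep) := by
  -- The forms vanishing on `S` lie between the multiples of `l` and the forms vanishing on `T`,
  -- both of dimension 3.
  have h3 : Module.finrank F (vanishingForms (T : Set (Plane F))) = 3 := by
    have := finrank_vanishingForms T (by omega) fun T' hT' h4 => by
      have := Finset.card_le_card hT'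
      omega
    omega
  have hr : Module.finrank F (LinearMap.range (mulForm l.rep)) = 3 := by
    rw [LinearMap.finrank_range_of_inj (mulForm_injective l.rep_nonzero)]
    simp
  have hle : LinearMap.range (mulForm l.rep) ≤ vanishingForms S := by
    rintro _ ⟨b, rfl⟩ P hP
    rw [mulForm_dotProduct_monomials, (mem_iff_dotProduct P l).1 (hSl P hP), zero_mul]
  have := Submodule.eq_of_le_of_finrank_eq (hle.trans (vanishingForms_anti hTS)) (hr.trans h3.symm)
  exact le_antisymm ((vanishingForms_anti hTS).trans this.ge) hle

end Forms

end Veronese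

namespace Veronese

open Configuration Configuration.ofField Matrix

/-! ### Linear systems with a fixed line, and their common zeros. -/

section LineForms

variable {F : Type*} [Field F]

/-- The reducible forms divisible by the equation of a line. -/
noncomputable def lineForms (l : Plane F) : Submodule F (Fin 6 → F) := LinearMap.range (mulForm l.rep)

theorem finrank_lineForms (l : Plane F) : Module.finrank F (lineForms l) = 3 := by
  rw [lineForms, LinearMap.finrank_range_of_inj (mulForm_injective l.rep_nonzero)]
  simp

theorem vanishingForms_eq_lineForms {l : Plane F} {S : Finset (Plane F)} (hSl : ∀ P ∈ S, P ∈ l)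
    (hS : 3 ≤ S.card) : vanishingForms (S : Set (Plane F)) = lineForms l := by
  obtain ⟨T, hTS, hT⟩ := Finset.exists_subset_card_eq hS
  exact vanishingForms_eq_range hSl hT (by exact_mod_cast hTS)

end LineForms

section CommonZeros

variable {F : Type*} [Field F] [Fintype (Plane F)]

open scoped Classical in
/-- The common zeros in the projective plane of a linear system of conics. -/
noncomputable def zeros (D : Submodule F (Fin 6 → F)) : Finset (Plane F) :=
  Finset.univ.filter fun P => ∀ c ∈ D, c ⬝ᵥ monomials P.rep = 0

theorem mem_zeros {D : Submodule F (Fin 6 → F)} {P : Plane F} :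
    P ∈ zeros D ↔ ∀ c ∈ D, c ⬝ᵥ monomials P.rep = 0 := by
  simp [zeros]

theorem subset_zeros_iff {D : Submodule F (Fin 6 → F)} {S : Finset (Plane F)} :
    S ⊆ zeros D ↔ D ≤ vanishingForms (S : Set (Plane F)) :=
  ⟨fun h c hc _ hP => mem_zeros.1 (h hP) c hc, fun h _ hP => mem_zeros.2 fun _ hc => h hc _ hP⟩

theorem finrank_add_card_le {D : Submodule F (Fin 6 → F)} {T : Finset (Plane F)} (hT : T ⊆ zeros D)
    (hcard : T.card ≤ 5) (hT4 : ∀ T' ⊆ T, T'.card = 4 → ¬ ∃ l : Plane F, ∀ P ∈ T', P ∈ l) :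
    Module.finrank F D + T.card ≤ 6 := by
  have h1 := finrank_vanishingForms T hcard hT4
  have h2 := Submodule.finrank_mono (subset_zeros_iff.1 hT)
  omega

theorem finrank_add_le_of_le_card {D : Submodule F (Fin 6 → F)} {k : ℕ} (hk : k ≤ 3)
    (h : k ≤ (zeros D).card) : Module.finrank F D + k ≤ 6 := by
  obtain ⟨T, hT, rfl⟩ := Finset.exists_subset_card_eq h
  refine finrank_add_card_le hT (by omega) fun T' hT' h4 => ?_
  have := Finset.card_le_card hT'
  omega

theorem zeros_lineForms (l : Plane F) : zeros (lineForms l) = linePoints l := by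
  ext P
  rw [mem_zeros, mem_linePoints]
  constructor
  · intro h
    -- A cofactor not vanishing at `P` makes the product vanish there only if `l` does.
    obtain ⟨m, hm⟩ := Nondegenerate.exists_line (L := Plane F) P
    have := h _ ⟨m.rep, rfl⟩
    rw [mulForm_dotProduct_monomials, mul_eq_zero] at this
    rw [mem_iff_dotProduct] at hm ⊢
    exact this.resolve_right hm
  · rintro h _ ⟨b, rfl⟩
    rw [mulForm_dotProduct_monomials, (mem_iff_dotProduct P l).1 h, zero_mul]

theorem linePoints_subset_zeros_iff [Fintype F] (l : Plane F)
    {D : Submodule F (Fin 6 → F)} : linePoints l ⊆ zeros D ↔ D ≤ lineForms l := by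
  have := Fintype.one_lt_card (α := F)
  rw [subset_zeros_iff, vanishingForms_eq_lineForms (fun P hP => mem_linePoints.1 hP)]
  rw [card_linePoints]
  omega

theorem card_inter_linePoints_le [DecidableEq (Plane F)] {l m : Plane F} (h : l ≠ m) :
    (linePoints l ∩ linePoints m).card ≤ 1 := by
  rw [Finset.card_le_one]
  intro P hP Q hQ
  by_contra hPQ
  simp only [Finset.mem_inter, mem_linePoints] at hP hQ
  exact h (line_unique hPQ hP.1 hQ.1 hP.2 hQ.2)

theorem linePoints_injective [Fintype F] :
    Function.Injective (linePoints : Plane F → Finset (Plane F)) := by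
  classical
  intro l m h
  by_contra hne
  have h1 := card_inter_linePoints_le hne
  rw [h, Finset.inter_self, card_linePoints] at h1
  have := Fintype.one_lt_card (α := F)
  omega

/-- Four non-collinear common zeros would leave dimension at most 2, so any four are collinear and
dimensions force equality. -/
theorem eq_lineForms_of_four_le_card {D : Submodule F (Fin 6 → F)}
    (hD : Module.finrank F D = 3) (h : 4 ≤ (zeros D).card) : ∃ l : Plane F, D = lineForms l := by
  obtain ⟨T, hT, h4⟩ := Finset.exists_subset_card_eq h
  by_cases hcol : ∃ l : Plane F, ∀ P ∈ T, P ∈ l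
  · obtain ⟨l, hl⟩ := hcol
    refine ⟨l, Submodule.eq_of_le_of_finrank_eq ?_ (hD.trans (finrank_lineForms l).symm)⟩
    rw [← vanishingForms_eq_lineForms hl (by omega)]
    exact subset_zeros_iff.1 hT
  · have := finrank_add_card_le hT (by omega) fun T' hT' h4' => by
      rwa [Finset.eq_of_subset_of_card_le hT' (by omega)]
    omega

/-- Five points with no four collinear leave only one conic. So four of the zeros are collinear, and
their line is a component of every member. -/
theorem le_lineForms_of_five_le_card {D : Submodule F (Fin 6 → F)}
    (hD : Module.finrank F D = 2) (h : 5 ≤ (zeros D).card) : ∃ l : Plane F, D ≤ lineForms l := by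
  obtain ⟨T, hT, h5⟩ := Finset.exists_subset_card_eq h
  by_contra! hno
  have := finrank_add_card_le hT (by omega) fun T' hT' h4 ⟨l, hl⟩ => by
    refine hno l ?_
    rw [← vanishingForms_eq_lineForms hl (by omega)]
    exact subset_zeros_iff.1 (hT'.trans hT)
  omega

/-- A set consisting of at most three points of a line and at most two points off this line has
no four collinear points. -/
theorem not_collinear_of_subset_union [DecidableEq (Plane F)] {l : Plane F}
    {S E T : Finset (Plane F)} (hS : ∀ P ∈ S, P ∈ l) (hS3 : S.card ≤ 3)
    (hE : ∀ P ∈ E, P ∉ l) (hE2 : E.card ≤ 2) (hT : T ⊆ S ∪ E) (hT4 : T.card = 4) :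
    ¬ ∃ m : Plane F, ∀ P ∈ T, P ∈ m := by
  rintro ⟨m, hm⟩
  by_cases hlm : m = l
  · subst hlm
    have : T ⊆ S := fun P hP => (Finset.mem_union.1 (hT hP)).resolve_right
      fun h => hE P h (hm P hP)
    have := Finset.card_le_card this
    omega
  · have h1 : (T ∩ S).card ≤ 1 := (Finset.card_le_card fun P hP => by
      rw [Finset.mem_inter] at hP
      simp [hm P hP.1, hS P hP.2]).trans (card_inter_linePoints_le hlm)
    have h2 : (T \ S).card ≤ 2 := (Finset.card_le_card fun P hP => by
      rw [Finset.mem_sdiff] at hP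
      exact (Finset.mem_union.1 (hT hP.1)).resolve_left hP.2).trans hE2
    have := Finset.card_inter_add_card_sdiff T S
    omega

variable [Fintype F]

theorem exists_three_points (l : Plane F) :
    ∃ S : Finset (Plane F), (∀ P ∈ S, P ∈ l) ∧ S.card = 3 := by
  have := Fintype.one_lt_card (α := F)
  obtain ⟨S, hS, h3⟩ := Finset.exists_subset_card_eq (s := linePoints l) (n := 3)
    (by rw [card_linePoints]; omega)
  exact ⟨S, fun P hP => mem_linePoints.1 (hS hP), h3⟩

open scoped Classical in
-- Removing `l` leaves a pencil of lines, which has one base point. In the proof, two zeros off `l`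
-- and three points of `l` would impose five independent conditions.
theorem card_zeros_sdiff_le_one {l : Plane F} {D : Submodule F (Fin 6 → F)}
    (hD : Module.finrank F D = 2) (hDl : D ≤ lineForms l) :
    (zeros D \ linePoints l).card ≤ 1 := by
  by_contra! h
  obtain ⟨E, hE, hE2⟩ := Finset.exists_subset_card_eq (Nat.succ_le_of_lt h)
  obtain ⟨S, hSl, hS3⟩ := exists_three_points l
  have hEl : ∀ P ∈ E, P ∉ l := fun P hP => by
    simpa using (Finset.mem_sdiff.1 (hE hP)).2
  have hdisj : Disjoint S E :=
    Finset.disjoint_left.2 fun P hP hP' => hEl P hP' (hSl P hP)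
  have hcard : (S ∪ E).card = 5 := by rw [Finset.card_union_of_disjoint hdisj]; omega
  have hsub : S ∪ E ⊆ zeros D := by
    refine Finset.union_subset (fun P hP => ?_) fun P hP => (Finset.mem_sdiff.1 (hE hP)).1
    exact (linePoints_subset_zeros_iff l).2 hDl (by simpa using hSl P hP)
  have := finrank_add_card_le hsub hcard.le fun T hT hT4 =>
    not_collinear_of_subset_union hSl hS3.le hEl (by omega) hT hT4
  omega

open scoped Classical in
-- `P` and three points of `l` impose four independent conditions; the other points of `l` then come
-- for free.
theorem finrank_vanishingForms_insert_linePoints {l P : Plane F} (hP : P ∉ l) :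
    Module.finrank F
      (vanishingForms ((insert P (linePoints l) : Finset (Plane F)) : Set (Plane F))) = 2 := by
  obtain ⟨S, hSl, hS3⟩ := exists_three_points l
  have hPS : P ∉ S := fun h => hP (hSl P h)
  have h := finrank_vanishingForms (insert P S)
    (by rw [Finset.card_insert_of_notMem hPS]; omega) fun T hT hT4 =>
      not_collinear_of_subset_union (E := {P}) hSl hS3.le (by simpa using hP) (by simp)
        (by rwa [Finset.union_comm, ← Finset.insert_eq]) hT4
  rw [Finset.card_insert_of_notMem hPS, hS3] at h
  have heq : vanishingForms ((insert P (linePoints l) : Finset (Plane F)) : Set (Plane F)) =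
      vanishingForms ((insert P S : Finset (Plane F)) : Set (Plane F)) := by
    refine le_antisymm (vanishingForms_anti ?_) fun c hc Q hQ => ?_
    · exact_mod_cast Finset.insert_subset_insert P fun Q hQ => by simpa using hSl Q hQ
    · rcases Finset.mem_insert.1 (Finset.mem_coe.1 hQ) with rfl | hQ
      · exact hc Q (by simp)
      · have : c ∈ lineForms l := by
          rw [← vanishingForms_eq_lineForms hSl hS3.ge]
          exact fun R hR => hc R (by simp [Finset.mem_coe.1 hR])
        exact mem_zeros.1 ((linePoints_subset_zeros_iff l).2 le_rfl hQ) c this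
  rw [heq]
  omega

open scoped Classical in
theorem card_zeros_of_le_lineForms {l : Plane F} {D : Submodule F (Fin 6 → F)}
    (hDl : D ≤ lineForms l) :
    (zeros D).card = Fintype.card F + 1 + (zeros D \ linePoints l).card := by
  rw [← card_linePoints l, Finset.card_sdiff_of_subset ((linePoints_subset_zeros_iff l).2 hDl)]
  have := Finset.card_le_card ((linePoints_subset_zeros_iff l).2 hDl)
  omega

/-- A second fixed line would give at least `q ≥ 2` common zeros off `l`, where at most one is
allowed. -/
theorem line_unique_of_le_lineForms {l m : Plane F} {D : Submodule F (Fin 6 → F)}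
    (hD : Module.finrank F D = 2) (hl : D ≤ lineForms l) (hm : D ≤ lineForms m) : l = m := by
  classical
  by_contra h
  have h1 := card_zeros_sdiff_le_one hD hl
  have h2 := card_inter_linePoints_le h
  have h3 : (linePoints m \ linePoints l).card ≤ (zeros D \ linePoints l).card :=
    Finset.card_le_card (Finset.sdiff_subset_sdiff ((linePoints_subset_zeros_iff m).2 hm) le_rfl)
  have h4 := Finset.card_inter_add_card_sdiff (linePoints m) (linePoints l)
  rw [card_linePoints, Finset.inter_comm] at h4
  have := Fintype.one_lt_card (α := F)
  omega

end CommonZeros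

/-! ### Double counting of linear systems and their zeros. -/

section Counting

/-- The number of `r`-dimensional subspaces of an `m`-dimensional space over a field with `q`
elements. -/
def gaussianBinomial (q : ℚ) (m r : ℕ) : ℚ :=
  (∏ i : Fin r, (q ^ m - q ^ i.val)) / ∏ i : Fin r, (q ^ r - q ^ i.val)

theorem gaussianBinomial_denominator_ne_zero {q : ℚ} (hq : 1 < q) (r : ℕ) :
    ∏ i : Fin r, (q ^ r - q ^ i.val) ≠ 0 := by
  rw [Finset.prod_ne_zero_iff]
  intro i _
  exact (sub_pos.2 (pow_lt_pow_right₀ hq i.2)).ne'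

theorem gaussianBinomial_eq {q x : ℚ} (hq : 1 < q) {m r : ℕ}
    (h : ∏ i : Fin r, (q ^ m - q ^ i.val) = x * ∏ i : Fin r, (q ^ r - q ^ i.val)) :
    gaussianBinomial q m r = x := by
  rw [gaussianBinomial, div_eq_iff (gaussianBinomial_denominator_ne_zero hq r), h]

theorem gaussianBinomial_self {q : ℚ} (hq : 1 < q) (m : ℕ) : gaussianBinomial q m m = 1 :=
  gaussianBinomial_eq hq (one_mul _).symm

theorem gaussianBinomial_three_two {q : ℚ} (hq : 1 < q) :
    gaussianBinomial q 3 2 = q ^ 2 + q + 1 :=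
  gaussianBinomial_eq hq (by simp [Fin.prod_univ_succ]; ring)

variable {F : Type*} [Field F] [Fintype (Submodule F (Fin 6 → F))]

open scoped Classical in
/-- The `r`-dimensional linear systems contained in `W`. -/
noncomputable def systemsIn (W : Submodule F (Fin 6 → F)) (r : ℕ) :
    Finset (Submodule F (Fin 6 → F)) :=
  Finset.univ.filter fun D => D ≤ W ∧ Module.finrank F D = r

theorem mem_systemsIn {W D : Submodule F (Fin 6 → F)} {r : ℕ} :
    D ∈ systemsIn W r ↔ D ≤ W ∧ Module.finrank F D = r := by
  simp [systemsIn]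

theorem card_systemsIn [Fintype F] {W : Submodule F (Fin 6 → F)} {r m : ℕ} (hW : Module.finrank F W = m)
    (hr : r ≤ m) : ((systemsIn W r).card : ℚ) = gaussianBinomial (Fintype.card F) m r := by
  rw [gaussianBinomial, eq_div_iff, systemsIn, card_subspaces_le_mul W hW hr]
  exact gaussianBinomial_denominator_ne_zero (by exact_mod_cast Fintype.one_lt_card) r

variable [Fintype (Plane F)]

/-- The number of linear systems of conics of dimension `r` with `k` common zeros. -/
noncomputable def countSystems (F : Type*) [Field F] [Fintype (Plane F)]
    [Fintype (Submodule F (Fin 6 → F))] (r k : ℕ) : ℕ :=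
  ((systemsIn (F := F) ⊤ r).filter fun D => (zeros D).card = k).card

theorem sum_systemsIn_eq (r : ℕ) (K : Finset ℕ)
    (hK : ∀ D ∈ systemsIn (F := F) ⊤ r, (zeros D).card ∈ K) (f : ℕ → ℚ) :
    ∑ D ∈ systemsIn (F := F) ⊤ r, f (zeros D).card = ∑ k ∈ K, countSystems F r k * f k := by
  rw [← Finset.sum_fiberwise_of_maps_to hK]
  refine Finset.sum_congr rfl fun k _ => ?_
  rw [countSystems, ← nsmul_eq_mul, ← Finset.sum_const]
  exact Finset.sum_congr rfl fun D hD => by rw [(Finset.mem_filter.1 hD).2]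

/-- Both sides count pairs of a system `D` and a `j`-set `S` of its common zeros. -/
theorem sum_choose_card_zeros (r j : ℕ) :
    ∑ D ∈ systemsIn (F := F) ⊤ r, (zeros D).card.choose j =
      ∑ S ∈ Finset.powersetCard j (Finset.univ : Finset (Plane F)),
        (systemsIn (vanishingForms (S : Set (Plane F))) r).card := by
  classical
  simp_rw [← Finset.card_powersetCard]
  have h1 : ∀ D : Submodule F (Fin 6 → F), Finset.powersetCard j (zeros D) =
      (Finset.powersetCard j Finset.univ).filter fun S => S ⊆ zeros D := by
    intro D; ext S; simp [Finset.mem_powersetCard, and_comm]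
  have h2 : ∀ S : Finset (Plane F), systemsIn (vanishingForms (S : Set (Plane F))) r =
      (systemsIn ⊤ r).filter fun D => S ⊆ zeros D := by
    intro S; ext D; simp [mem_systemsIn, subset_zeros_iff, and_comm]
  simp_rw [h1, h2]
  exact Finset.sum_card_bipartiteAbove_eq_sum_card_bipartiteBelow (fun D S => S ⊆ zeros D)

variable [Fintype F]

theorem sum_choose_card_zeros_of_le_three {r j : ℕ} (hj : j ≤ 3) (hr : r + j ≤ 6) :
    (∑ D ∈ systemsIn (F := F) ⊤ r, ((zeros D).card.choose j : ℚ)) =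
      ((Fintype.card F ^ 2 + Fintype.card F + 1).choose j : ℕ) *
        gaussianBinomial (Fintype.card F) (6 - j) r := by
  rw [← Nat.cast_sum, sum_choose_card_zeros, Nat.cast_sum, ← card_plane, ← Finset.card_univ,
    ← Finset.card_powersetCard, ← nsmul_eq_mul, ← Finset.sum_const]
  refine Finset.sum_congr rfl fun S hS => card_systemsIn ?_ (by omega)
  have hS' := (Finset.mem_powersetCard.1 hS).2
  have := finrank_vanishingForms S (by omega) fun T hT h4 => by
    have := Finset.card_le_card hT
    omega
  omega

/-- Four points leave dimension 2, or 3 when collinear. The second term corrects for collinear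
quadruples, each lying on a unique line. -/
theorem sum_choose_four_card_zeros :
    (∑ D ∈ systemsIn (F := F) ⊤ 2, ((zeros D).card.choose 4 : ℚ)) =
      ((Fintype.card F ^ 2 + Fintype.card F + 1).choose 4 : ℕ) *
          gaussianBinomial (Fintype.card F) 2 2 +
        (Fintype.card F ^ 2 + Fintype.card F + 1) * ((Fintype.card F + 1).choose 4 : ℕ) *
          (gaussianBinomial (Fintype.card F) 3 2 - gaussianBinomial (Fintype.card F) 2 2) := by
  classical
  have hcol : ((Finset.powersetCard 4 (Finset.univ : Finset (Plane F))).filter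
      fun S => ∃ l : Plane F, ∀ P ∈ S, P ∈ l).card =
      (Fintype.card F ^ 2 + Fintype.card F + 1) * (Fintype.card F + 1).choose 4 := by
    have : (Finset.powersetCard 4 (Finset.univ : Finset (Plane F))).filter
        (fun S => ∃ l : Plane F, ∀ P ∈ S, P ∈ l) =
        Finset.univ.biUnion fun l : Plane F => Finset.powersetCard 4 (linePoints l) := by
      ext S
      simp only [Finset.mem_filter, Finset.mem_powersetCard, Finset.mem_biUnion, Finset.mem_univ,
        true_and, Finset.subset_iff, mem_linePoints]
      tauto
    rw [this, Finset.card_biUnion]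
    · simp_rw [Finset.card_powersetCard, card_linePoints]
      rw [Finset.sum_const, Finset.card_univ, card_plane, smul_eq_mul]
    · intro l _ m _ hlm
      refine Finset.disjoint_left.2 fun S hS hS' => ?_
      rw [Finset.mem_powersetCard] at hS hS'
      have := Finset.card_le_card (Finset.subset_inter hS.1 hS'.1)
      have := card_inter_linePoints_le hlm
      omega
  have hterm : ∀ S ∈ Finset.powersetCard 4 (Finset.univ : Finset (Plane F)),
      ((systemsIn (vanishingForms (S : Set (Plane F))) 2).card : ℚ) =
        gaussianBinomial (Fintype.card F) 2 2 + if (∃ l : Plane F, ∀ P ∈ S, P ∈ l) then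
          gaussianBinomial (Fintype.card F) 3 2 - gaussianBinomial (Fintype.card F) 2 2 else 0 := by
    intro S hS
    have hS' := (Finset.mem_powersetCard.1 hS).2
    split_ifs with h
    · obtain ⟨l, hl⟩ := h
      rw [vanishingForms_eq_lineForms hl (by omega),
        card_systemsIn (finrank_lineForms l) (by omega)]
      ring
    · have := finrank_vanishingForms S (by omega) fun T hT h4 => by
        rwa [Finset.eq_of_subset_of_card_le hT (by omega)]
      rw [card_systemsIn (m := 2) (by omega) le_rfl, add_zero]
  rw [← Nat.cast_sum, sum_choose_card_zeros, Nat.cast_sum, Finset.sum_congr rfl hterm,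
    Finset.sum_add_distrib, Finset.sum_const, Finset.card_powersetCard, Finset.card_univ,
    card_plane, nsmul_eq_mul, ← Finset.sum_filter, Finset.sum_const, hcol, nsmul_eq_mul]
  push_cast
  rfl

/-- These systems are exactly the `lineForms l`: the bound on `q` gives `q + 1 ≥ 4` zeros. -/
theorem countSystems_three_line (hF : 3 ≤ Fintype.card F) :
    countSystems F 3 (Fintype.card F + 1) = Fintype.card F ^ 2 + Fintype.card F + 1 := by
  classical
  rw [← card_plane, ← Finset.card_univ (α := Plane F), countSystems]
  symm
  refine Finset.card_bij (fun l _ => lineForms l) (fun l _ => ?_) (fun l _ m _ h => ?_)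
    fun D hD => ?_
  · rw [Finset.mem_filter, mem_systemsIn, zeros_lineForms, card_linePoints]
    exact ⟨⟨le_top, finrank_lineForms l⟩, rfl⟩
  · apply linePoints_injective
    rw [← zeros_lineForms, h, zeros_lineForms]
  · rw [Finset.mem_filter, mem_systemsIn] at hD
    obtain ⟨l, rfl⟩ := eq_lineForms_of_four_le_card hD.1.2 (by omega)
    exact ⟨l, Finset.mem_univ _, rfl⟩

open scoped Classical in
-- Such systems correspond to the base point of the residual pencil of lines, here any of the `q ^
-- 2` points off `l`.
theorem card_filter_card_zeros_sdiff_eq_one (l : Plane F) :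
    ((systemsIn (lineForms l) 2).filter fun D => (zeros D \ linePoints l).card = 1).card =
      Fintype.card F ^ 2 := by
  have hq : (1 : ℚ) < Fintype.card F := by exact_mod_cast Fintype.one_lt_card
  have h1 : ∀ D ∈ systemsIn (lineForms l) 2,
      (if (zeros D \ linePoints l).card = 1 then 1 else 0) =
        ((linePoints l)ᶜ.filter fun P => P ∈ zeros D).card := by
    intro D hD
    rw [mem_systemsIn] at hD
    have h := card_zeros_sdiff_le_one hD.2 hD.1
    have : (linePoints l)ᶜ.filter (fun P => P ∈ zeros D) = zeros D \ linePoints l := by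
      ext P; simp [and_comm]
    rw [this]
    split_ifs <;> omega
  have h2 : ∀ P ∈ (linePoints l)ᶜ,
      ((systemsIn (lineForms l) 2).filter fun D => P ∈ zeros D).card = 1 := by
    intro P hP
    have hP' : P ∉ l := by simpa using hP
    have : (systemsIn (lineForms l) 2).filter (fun D => P ∈ zeros D) = systemsIn
        (vanishingForms ((insert P (linePoints l) : Finset (Plane F)) : Set (Plane F))) 2 := by
      ext D
      rw [Finset.mem_filter, mem_systemsIn, mem_systemsIn, ← subset_zeros_iff,
        Finset.insert_subset_iff, linePoints_subset_zeros_iff]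
      tauto
    have h := card_systemsIn (finrank_vanishingForms_insert_linePoints hP') le_rfl
    rw [gaussianBinomial_self hq, ← this] at h
    exact_mod_cast h
  have h3 := Finset.sum_card_bipartiteAbove_eq_sum_card_bipartiteBelow
    (s := systemsIn (lineForms l) 2) (t := (linePoints l)ᶜ) fun D P => P ∈ zeros D
  simp only [Finset.bipartiteAbove, Finset.bipartiteBelow] at h3
  rw [Finset.card_filter, Finset.sum_congr rfl h1, h3, Finset.sum_congr rfl h2, Finset.sum_const, Finset.card_compl, card_linePoints, card_plane,
    smul_eq_mul, mul_one]
  omega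

open scoped Classical in
-- The remaining pencils, with base point on `l`, obtained by subtracting from the total `q ^ 2 + q
-- + 1`.
theorem card_filter_card_zeros_sdiff_eq_zero (l : Plane F) :
    ((systemsIn (lineForms l) 2).filter fun D => (zeros D \ linePoints l).card = 0).card =
      Fintype.card F + 1 := by
  have hq : (1 : ℚ) < Fintype.card F := by exact_mod_cast Fintype.one_lt_card
  have h := card_systemsIn (finrank_lineForms l) (r := 2) (by omega)
  rw [gaussianBinomial_three_two hq] at h
  have h' : (systemsIn (lineForms l) 2).card = Fintype.card F ^ 2 + Fintype.card F + 1 := by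
    exact_mod_cast h
  have h2 : (systemsIn (lineForms l) 2).filter (fun D => ¬ (zeros D \ linePoints l).card = 1) =
      (systemsIn (lineForms l) 2).filter fun D => (zeros D \ linePoints l).card = 0 := by
    refine Finset.filter_congr fun D hD => ?_
    rw [mem_systemsIn] at hD
    have := card_zeros_sdiff_le_one hD.2 hD.1
    omega
  have h3 := Finset.card_filter_add_card_filter_not (s := systemsIn (lineForms l) 2)
    fun D => (zeros D \ linePoints l).card = 1
  rw [h2, card_filter_card_zeros_sdiff_eq_one] at h3
  omega

open scoped Classical in
-- With `q ≥ 4` there are at least five zeros, hence a fixed line. It is unique, so the counts for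
-- the individual lines add up.
theorem countSystems_two_line (hF : 4 ≤ Fintype.card F) {e N : ℕ}
    (hN : ∀ l : Plane F, ((systemsIn (lineForms l) 2).filter
      fun D => (zeros D \ linePoints l).card = e).card = N) :
    countSystems F 2 (Fintype.card F + 1 + e) =
      (Fintype.card F ^ 2 + Fintype.card F + 1) * N := by
  have : (systemsIn (F := F) ⊤ 2).filter (fun D => (zeros D).card = Fintype.card F + 1 + e) =
      Finset.univ.biUnion fun l : Plane F => (systemsIn (lineForms l) 2).filter
        fun D => (zeros D \ linePoints l).card = e := by
    ext D
    simp only [Finset.mem_filter, Finset.mem_biUnion, Finset.mem_univ, true_and, mem_systemsIn,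
      le_top]
    constructor
    · rintro ⟨hD, hcard⟩
      obtain ⟨l, hl⟩ := le_lineForms_of_five_le_card hD (by omega)
      refine ⟨l, ⟨hl, hD⟩, ?_⟩
      have := card_zeros_of_le_lineForms hl
      omega
    · rintro ⟨l, ⟨hl, hD⟩, he⟩
      exact ⟨hD, by rw [card_zeros_of_le_lineForms hl, he]⟩
  rw [countSystems, this, Finset.card_biUnion, Finset.sum_congr rfl fun l _ => hN l,
    Finset.sum_const, Finset.card_univ, card_plane, smul_eq_mul]
  intro l _ m _ hlm
  refine Finset.disjoint_left.2 fun D hD hD' => hlm ?_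
  rw [Finset.mem_filter, mem_systemsIn] at hD hD'
  exact line_unique_of_le_lineForms hD.1.2 hD.1.1 hD'.1.1

end Counting

end Veronese

namespace Veronese

open Configuration Configuration.ofField Matrix

/-! ### The number of rational points of one conic. -/

section SingleConic

variable {F : Type*} [Field F]

/-- The polar form of a quadratic form `c` with respect to `u`, as a coefficient vector. -/
def polarVector (c : Fin 6 → F) (u : Fin 3 → F) : Fin 3 → F :=
  ![2 * c 0 * u 0 + c 1 * u 1 + c 2 * u 2, c 1 * u 0 + 2 * c 3 * u 1 + c 4 * u 2,
    c 2 * u 0 + c 4 * u 1 + 2 * c 5 * u 2]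

/-- The restriction of a conic to a line. The polar form is the coefficient of `x`, so nothing is
divided by 2 and even characteristic is covered. -/
theorem dotProduct_monomials_smul_add (c : Fin 6 → F) (x : F) (u v : Fin 3 → F) :
    c ⬝ᵥ monomials (x • u + v) =
      x ^ 2 * (c ⬝ᵥ monomials u) + x * (v ⬝ᵥ polarVector c u) + c ⬝ᵥ monomials v := by
  simp [polarVector, monomials, dotProduct, Fin.sum_univ_succ]
  ring

theorem dotProduct_polarVector_self (c : Fin 6 → F) (u : Fin 3 → F) :
    u ⬝ᵥ polarVector c u = 2 * (c ⬝ᵥ monomials u) := by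
  simp [polarVector, monomials, dotProduct, Fin.sum_univ_succ]
  ring

theorem smul_rep_add_rep_ne_zero {P Q : Plane F} (h : P ≠ Q) (x : F) :
    x • P.rep + Q.rep ≠ 0 := by
  intro h0
  apply h
  rw [← P.mk_rep, ← Q.mk_rep]
  symm
  rw [Projectivization.mk_eq_mk_iff']
  exact ⟨-x, by rw [neg_smul, neg_eq_iff_add_eq_zero, h0]⟩

/-- The point with coordinate vector `x P + Q`. -/
noncomputable def combine (x : F) {P Q : Plane F} (h : P ≠ Q) : Plane F :=
  Projectivization.mk F (x • P.rep + Q.rep) (smul_rep_add_rep_ne_zero h x)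

theorem combine_mem {P Q l : Plane F} (h : P ≠ Q) (x : F) (hP : P ∈ l) (hQ : Q ∈ l) :
    combine x h ∈ l := by
  rw [mem_iff_dotProduct] at hP hQ
  rw [combine, mk_mem_iff, add_dotProduct, smul_dotProduct, hP, hQ]
  simp

theorem combine_ne_left {P Q : Plane F} (h : P ≠ Q) (x : F) : combine x h ≠ P := by
  intro h0
  apply h
  conv_rhs at h0 => rw [← P.mk_rep]
  rw [combine, Projectivization.mk_eq_mk_iff'] at h0
  obtain ⟨a, ha⟩ := h0
  rw [← P.mk_rep, ← Q.mk_rep]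
  symm
  rw [Projectivization.mk_eq_mk_iff']
  exact ⟨a - x, by rw [sub_smul, ha]; simp⟩

theorem combine_one_ne_right {P Q : Plane F} (h : P ≠ Q) : combine 1 h ≠ Q := by
  intro h0
  apply h
  conv_rhs at h0 => rw [← Q.mk_rep]
  rw [combine, Projectivization.mk_eq_mk_iff'] at h0
  obtain ⟨a, ha⟩ := h0
  rw [← P.mk_rep, ← Q.mk_rep]
  rw [Projectivization.mk_eq_mk_iff']
  exact ⟨a - 1, by rw [sub_smul, ha]; simp⟩

/-- At a zero `P` the quadratic term drops out, so the second intersection of a line with the conic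
solves a linear equation. -/
theorem combine_zero_iff {P Q : Plane F} (h : P ≠ Q) (x : F) {c : Fin 6 → F}
    (hP : c ⬝ᵥ monomials P.rep = 0) :
    c ⬝ᵥ monomials (combine x h).rep = 0 ↔
      x * (Q.rep ⬝ᵥ polarVector c P.rep) + c ⬝ᵥ monomials Q.rep = 0 := by
  rw [combine, dotProduct_monomials_mk_rep, dotProduct_monomials_smul_add, hP, mul_zero, zero_add]

theorem exists_ne_mem [Fintype F] [Fintype (Plane F)] (P l : Plane F) :
    ∃ Q : Plane F, Q ≠ P ∧ Q ∈ l := by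
  classical
  have h : 1 < (linePoints l).card := by
    have := Fintype.card_pos (α := F)
    rw [card_linePoints]; omega
  obtain ⟨Q, hQ, hne⟩ := Finset.exists_mem_ne h P
  exact ⟨Q, hne, mem_linePoints.1 hQ⟩

theorem mem_lineForms_of_three_zeros {c : Fin 6 → F} {l P Q R : Plane F} (hPQ : P ≠ Q)
    (hPR : P ≠ R) (hQR : Q ≠ R) (hP : P ∈ l) (hQ : Q ∈ l) (hR : R ∈ l)
    (hcP : c ⬝ᵥ monomials P.rep = 0) (hcQ : c ⬝ᵥ monomials Q.rep = 0)
    (hcR : c ⬝ᵥ monomials R.rep = 0) : c ∈ lineForms l := by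
  classical
  rw [← vanishingForms_eq_lineForms (S := {P, Q, R})]
  · intro X hX
    simp only [Finset.coe_insert, Finset.coe_singleton, Set.mem_insert_iff,
      Set.mem_singleton_iff] at hX
    rcases hX with rfl | rfl | rfl <;> assumption
  · intro X hX
    simp only [Finset.mem_insert, Finset.mem_singleton] at hX
    rcases hX with rfl | rfl | rfl <;> assumption
  · rw [Finset.card_eq_three.2 ⟨P, Q, R, hPQ, hPR, hQR, rfl⟩]

variable [Fintype (Plane F)]

theorem mem_zeros_span {c : Fin 6 → F} {P : Plane F} :
    P ∈ zeros (Submodule.span F {c}) ↔ c ⬝ᵥ monomials P.rep = 0 := by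
  rw [mem_zeros]
  refine ⟨fun h => h c (Submodule.mem_span_singleton_self c), fun h d hd => ?_⟩
  obtain ⟨a, rfl⟩ := Submodule.mem_span_singleton.1 hd
  rw [smul_dotProduct, h, smul_zero]

variable [Fintype F]

theorem card_zeros_mulForm (l : Plane F) {b : Fin 3 → F} (hb : b ≠ 0) :
    (zeros (Submodule.span F {mulForm l.rep b})).card = Fintype.card F + 1 ∨
      (zeros (Submodule.span F {mulForm l.rep b})).card = 2 * Fintype.card F + 1 := by
  classical
  have hz : zeros (Submodule.span F {mulForm l.rep b}) =
      linePoints l ∪ linePoints (Projectivization.mk F b hb) := by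
    ext P
    rw [mem_zeros_span, mulForm_dotProduct_monomials, mul_eq_zero, Finset.mem_union,
      mem_linePoints, mem_linePoints, mem_mk_iff, mem_iff_dotProduct]
  rw [hz]
  -- A double line has `q + 1` points; two distinct lines share one, leaving `2 (q + 1) - 1`.
  by_cases h : l = Projectivization.mk F b hb
  · left
    rw [← h, Finset.union_self, card_linePoints]
  · right
    have h1 := card_inter_linePoints_le h
    obtain ⟨P, hP, hP'⟩ := exists_point h
    have h2 : 0 < (linePoints l ∩ linePoints (Projectivization.mk F b hb)).card :=
      Finset.card_pos.2 ⟨P, by simp [hP, hP']⟩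
    have h3 := Finset.card_union_add_card_inter (linePoints l)
      (linePoints (Projectivization.mk F b hb))
    rw [card_linePoints, card_linePoints] at h3
    omega

/-- A conic without lines and with a rational point has one or `q + 1` rational points. -/
theorem card_zeros_of_no_line {c : Fin 6 → F} (hc : ∀ l : Plane F, c ∉ lineForms l) {P : Plane F}
    (hP : c ⬝ᵥ monomials P.rep = 0) :
    (zeros (Submodule.span F {c})).card = 1 ∨
      (zeros (Submodule.span F {c})).card = Fintype.card F + 1 := by
  classical
  -- Otherwise `P + Q` is a third zero on the line `PQ`, which becomes a component.
  have tangent : ∀ Q : Plane F, Q ≠ P → c ⬝ᵥ monomials Q.rep = 0 →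
      Q.rep ⬝ᵥ polarVector c P.rep ≠ 0 := by
    intro Q hQP hQ h0
    obtain ⟨l, hPl, hQl⟩ := exists_line hQP.symm
    refine hc l (mem_lineForms_of_three_zeros hQP.symm (combine_ne_left hQP.symm 1).symm
      (combine_one_ne_right hQP.symm).symm hPl hQl (combine_mem hQP.symm 1 hPl hQl) hP hQ ?_)
    rw [combine_zero_iff hQP.symm 1 hP, h0, hQ]
    simp
  -- A vanishing polar vector makes `P` singular, and `tangent` then excludes any other zero.
  -- Otherwise it defines the tangent line `t`, and the other zeros match the `q` remaining lines
  -- through `P`.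
  by_cases hpol : polarVector c P.rep = 0
  · left
    rw [Finset.card_eq_one]
    refine ⟨P, Finset.eq_singleton_iff_unique_mem.2 ⟨mem_zeros_span.2 hP, fun Q hQ => ?_⟩⟩
    by_contra hQP
    exact tangent Q hQP (mem_zeros_span.1 hQ) (by rw [hpol, dotProduct_zero])
  · right
    set t : Plane F := Projectivization.mk F _ hpol with ht
    have hPt : P ∈ t := by
      rw [ht, mem_mk_iff, dotProduct_polarVector_self, hP, mul_zero]
    have second : ∀ l : Plane F, l ∈ (pencil P).erase t →
        ∃ Q : Plane F, Q ≠ P ∧ Q ∈ l ∧ c ⬝ᵥ monomials Q.rep = 0 := by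
      intro l hl
      rw [Finset.mem_erase, mem_pencil] at hl
      obtain ⟨R, hRP, hRl⟩ := exists_ne_mem P l
      have hR : R.rep ⬝ᵥ polarVector c P.rep ≠ 0 := fun h =>
        hl.1 (line_unique hRP.symm hl.2 hRl hPt ((mem_mk_iff hpol R).2 h))
      refine ⟨combine (-(c ⬝ᵥ monomials R.rep) / (R.rep ⬝ᵥ polarVector c P.rep)) hRP.symm,
        combine_ne_left _ _, combine_mem _ _ hl.2 hRl, ?_⟩
      rw [combine_zero_iff _ _ hP, div_mul_cancel₀ _ hR, neg_add_cancel]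
    choose! f hfP hfl hf using second
    have hbij : ((pencil P).erase t).card = ((zeros (Submodule.span F {c})).erase P).card := by
      refine Finset.card_bij (fun l _ => f l) (fun l hl => ?_) (fun l hl m hm h => ?_)
        fun Q hQ => ?_
      · exact Finset.mem_erase.2 ⟨hfP l hl, mem_zeros_span.2 (hf l hl)⟩
      · have hPl := (mem_pencil.1 (Finset.mem_of_mem_erase hl))
        have hPm := (mem_pencil.1 (Finset.mem_of_mem_erase hm))
        exact line_unique (hfP l hl) (hfl l hl) hPl (h ▸ hfl m hm) hPm
      · rw [Finset.mem_erase, mem_zeros_span] at hQ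
        obtain ⟨l, hPl, hQl⟩ := exists_line (Ne.symm hQ.1)
        have hl : l ∈ (pencil P).erase t := by
          refine Finset.mem_erase.2 ⟨fun h => tangent Q hQ.1 hQ.2 ?_, mem_pencil.2 hPl⟩
          exact (mem_mk_iff hpol Q).1 (ht ▸ h ▸ hQl)
        refine ⟨l, hl, ?_⟩
        by_contra hne
        exact hc l (mem_lineForms_of_three_zeros (Ne.symm hQ.1) (hfP l hl).symm
          (Ne.symm hne) hPl hQl (hfl l hl) hP hQ.2 (hf l hl))
    rw [Finset.card_erase_of_mem (mem_pencil.2 hPt),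
      Finset.card_erase_of_mem (mem_zeros_span.2 hP), card_pencil] at hbij
    have : 0 < (zeros (Submodule.span F {c})).card := Finset.card_pos.2 ⟨P, mem_zeros_span.2 hP⟩
    omega

theorem card_zeros_of_finrank_eq_one {D : Submodule F (Fin 6 → F)}
    (hD : Module.finrank F D = 1) :
    (zeros D).card ∈ ({0, 1, Fintype.card F + 1, 2 * Fintype.card F + 1} : Finset ℕ) := by
  obtain ⟨c, hc0, rfl⟩ : ∃ c : Fin 6 → F, c ≠ 0 ∧ D = Submodule.span F {c} := by
    obtain ⟨v, hv, h⟩ := finrank_eq_one_iff'.1 hD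
    refine ⟨v, by simpa using hv, le_antisymm (fun w hw => ?_) ?_⟩
    · obtain ⟨a, ha⟩ := h ⟨w, hw⟩
      exact Submodule.mem_span_singleton.2 ⟨a, congrArg Subtype.val ha⟩
    · rw [Submodule.span_singleton_le_iff_mem]
      exact v.2
  simp only [Finset.mem_insert, Finset.mem_singleton]
  by_cases hl : ∃ l : Plane F, c ∈ lineForms l
  · obtain ⟨l, b, rfl⟩ := hl
    have hb : b ≠ 0 := fun h => hc0 (by rw [h, map_zero])
    rcases card_zeros_mulForm l hb with h | h <;> simp [h]
  · push Not at hl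
    by_cases hP : ∃ P : Plane F, c ⬝ᵥ monomials P.rep = 0
    · obtain ⟨P, hP⟩ := hP
      rcases card_zeros_of_no_line hl hP with h | h <;> simp [h]
    · left
      rw [Finset.card_eq_zero, Finset.eq_empty_iff_forall_notMem]
      exact fun P h => hP ⟨P, mem_zeros_span.1 h⟩

end SingleConic

end Veronese

namespace Veronese

open Configuration Configuration.ofField Matrix

/-! ### Solving the moment equations. -/

section Spectrum

theorem cast_choose_succ (n k : ℕ) :
    (n.choose (k + 1) : ℚ) = n.choose k * (n - k) / (k + 1) := by
  have h := congrArg (Nat.cast : ℕ → ℚ) (Nat.choose_succ_right_eq n k)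
  rw [eq_div_iff (by positivity)]
  rcases le_or_gt k n with hk | hk
  · rw [Nat.cast_mul, Nat.cast_mul, Nat.cast_sub hk] at h
    exact_mod_cast h
  · rw [Nat.choose_eq_zero_of_lt hk, Nat.choose_eq_zero_of_lt (by omega)]
    simp

theorem cast_choose_two_three_four (n : ℕ) :
    (n.choose 2 : ℚ) = n * (n - 1) / 2 ∧ (n.choose 3 : ℚ) = n * (n - 1) * (n - 2) / 6 ∧
      (n.choose 4 : ℚ) = n * (n - 1) * (n - 2) * (n - 3) / 24 := by
  have h2 := cast_choose_succ n 1
  have h3 := cast_choose_succ n 2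
  have h4 := cast_choose_succ n 3
  norm_num at h2 h3 h4
  refine ⟨h2, ?_, ?_⟩
  · rw [h3, h2]; ring
  · rw [h4, h3, h2]; ring

section GaussianValues

variable {q : ℚ}

theorem gaussianBinomial_three_one (hq : 1 < q) : gaussianBinomial q 3 1 = q ^ 2 + q + 1 :=
  gaussianBinomial_eq hq (by simp; ring)

theorem gaussianBinomial_four_one (hq : 1 < q) : gaussianBinomial q 4 1 = q ^ 3 + q ^ 2 + q + 1 :=
  gaussianBinomial_eq hq (by simp; ring)

theorem gaussianBinomial_five_one (hq : 1 < q) : gaussianBinomial q 5 1 = q ^ 4 + q ^ 3 + q ^ 2 + q + 1 :=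
  gaussianBinomial_eq hq (by simp; ring)

theorem gaussianBinomial_six_one (hq : 1 < q) : gaussianBinomial q 6 1 = q ^ 5 + q ^ 4 + q ^ 3 + q ^ 2 + q + 1 :=
  gaussianBinomial_eq hq (by simp; ring)

theorem gaussianBinomial_four_two (hq : 1 < q) : gaussianBinomial q 4 2 = (q ^ 2 + 1) * (q ^ 2 + q + 1) :=
  gaussianBinomial_eq hq (by simp [Fin.prod_univ_succ]; ring)

theorem gaussianBinomial_five_two (hq : 1 < q) :
    gaussianBinomial q 5 2 = (q ^ 2 + 1) * (q ^ 4 + q ^ 3 + q ^ 2 + q + 1) :=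
  gaussianBinomial_eq hq (by simp [Fin.prod_univ_succ]; ring)

theorem gaussianBinomial_six_two (hq : 1 < q) :
    gaussianBinomial q 6 2 = (q ^ 4 + q ^ 2 + 1) * (q ^ 4 + q ^ 3 + q ^ 2 + q + 1) :=
  gaussianBinomial_eq hq (by simp [Fin.prod_univ_succ]; ring)

theorem gaussianBinomial_four_three (hq : 1 < q) : gaussianBinomial q 4 3 = q ^ 3 + q ^ 2 + q + 1 :=
  gaussianBinomial_eq hq (by simp [Fin.prod_univ_succ]; ring)

theorem gaussianBinomial_five_three (hq : 1 < q) :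
    gaussianBinomial q 5 3 = (q ^ 2 + 1) * (q ^ 4 + q ^ 3 + q ^ 2 + q + 1) :=
  gaussianBinomial_eq hq (by simp [Fin.prod_univ_succ]; ring)

theorem gaussianBinomial_six_three (hq : 1 < q) :
    gaussianBinomial q 6 3 = (q ^ 3 + 1) * (q ^ 2 + 1) * (q ^ 4 + q ^ 3 + q ^ 2 + q + 1) :=
  gaussianBinomial_eq hq (by simp [Fin.prod_univ_succ]; ring)

theorem gaussianBinomial_five_four (hq : 1 < q) :
    gaussianBinomial q 5 4 = q ^ 4 + q ^ 3 + q ^ 2 + q + 1 :=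
  gaussianBinomial_eq hq (by simp [Fin.prod_univ_succ]; ring)

theorem gaussianBinomial_six_four (hq : 1 < q) :
    gaussianBinomial q 6 4 = (q ^ 4 + q ^ 2 + 1) * (q ^ 4 + q ^ 3 + q ^ 2 + q + 1) :=
  gaussianBinomial_eq hq (by simp [Fin.prod_univ_succ]; ring)

theorem gaussianBinomial_six_five (hq : 1 < q) :
    gaussianBinomial q 6 5 = q ^ 5 + q ^ 4 + q ^ 3 + q ^ 2 + q + 1 :=
  gaussianBinomial_eq hq (by simp [Fin.prod_univ_succ]; ring)

end GaussianValues

variable {F : Type*} [Field F] [Fintype (Plane F)]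

/-- A violation would supply `7 - finrank ≤ 3` zeros, and so few points always impose independent
conditions. -/
theorem card_zeros_add_finrank_le_six {D : Submodule F (Fin 6 → F)} (hD : 4 ≤ Module.finrank F D) :
    (zeros D).card + Module.finrank F D ≤ 6 := by
  by_contra! h
  have hle : Module.finrank F D ≤ 6 := by simpa using Submodule.finrank_le D
  have := finrank_add_le_of_le_card (D := D) (k := 7 - Module.finrank F D) (by omega) (by omega)
  omega

variable [Fintype F]

theorem card_zeros_of_finrank_eq_two {D : Submodule F (Fin 6 → F)} (hD : Module.finrank F D = 2) :
    (zeros D).card ∈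
      ({Fintype.card F + 2, Fintype.card F + 1, 4, 3, 2, 1, 0} : Finset ℕ) := by
  classical
  simp only [Finset.mem_insert, Finset.mem_singleton]
  by_cases h : 5 ≤ (zeros D).card
  · obtain ⟨l, hl⟩ := le_lineForms_of_five_le_card hD h
    have h1 := card_zeros_sdiff_le_one hD hl
    have h2 := card_zeros_of_le_lineForms hl
    omega
  · omega

theorem card_zeros_of_finrank_eq_three {D : Submodule F (Fin 6 → F)}
    (hD : Module.finrank F D = 3) :
    (zeros D).card ∈ ({Fintype.card F + 1, 3, 2, 1, 0} : Finset ℕ) := by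
  simp only [Finset.mem_insert, Finset.mem_singleton]
  by_cases h : 4 ≤ (zeros D).card
  · obtain ⟨l, rfl⟩ := eq_lineForms_of_four_le_card hD h
    rw [zeros_lineForms, card_linePoints]
    omega
  · omega

variable [Fintype (Submodule F (Fin 6 → F))]

/-- The moment equations for the numbers of systems with a given number of common zeros. -/
theorem sum_countSystems_mul_choose {r j : ℕ} (hj : j ≤ 3) (hr : r + j ≤ 6) (K : Finset ℕ)
    (hK : ∀ D : Submodule F (Fin 6 → F), Module.finrank F D = r → (zeros D).card ∈ K) :
    ∑ k ∈ K, (countSystems F r k : ℚ) * (k.choose j : ℕ) =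
      ((Fintype.card F ^ 2 + Fintype.card F + 1).choose j : ℕ) *
        gaussianBinomial (Fintype.card F) (6 - j) r := by
  rw [← sum_choose_card_zeros_of_le_three hj hr]
  exact (sum_systemsIn_eq r K (fun D hD => hK D (mem_systemsIn.1 hD).2)
    fun k => (k.choose j : ℚ)).symm

/-- Four moments determine the four unknowns. That every conic has a rational point is not an input:
it comes out of the solution. -/
theorem countSystems_one :
    countSystems F 1 0 = 0 ∧
    (countSystems F 1 1 : ℚ) = ((Fintype.card F : ℚ) ^ 4 - Fintype.card F) / 2 ∧
    (countSystems F 1 (Fintype.card F + 1) : ℚ) =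
      (Fintype.card F : ℚ) ^ 5 + Fintype.card F + 1 ∧
    (countSystems F 1 (2 * Fintype.card F + 1) : ℚ) = ((Fintype.card F : ℚ) ^ 4 +
      2 * (Fintype.card F : ℚ) ^ 3 + 2 * (Fintype.card F : ℚ) ^ 2 + Fintype.card F) / 2 := by
  have h1 := Fintype.one_lt_card (α := F)
  have hm := fun j hj hr => sum_countSystems_mul_choose (F := F) (r := 1) (j := j) hj hr _
    fun D hD => card_zeros_of_finrank_eq_one hD
  have e0 := hm 0 (by norm_num) (by norm_num)
  have e1 := hm 1 (by norm_num) (by norm_num)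
  have e2 := hm 2 (by norm_num) (by norm_num)
  have e3 := hm 3 (by norm_num) (by norm_num)
  clear hm
  have hq : (1 : ℚ) < Fintype.card F := by exact_mod_cast h1
  rw [Finset.sum_insert (by simp), Finset.sum_insert (by simp),
    Finset.sum_insert (by simp), Finset.sum_singleton] at e0 e1 e2 e3
  simp only [gaussianBinomial_six_one hq, gaussianBinomial_five_one hq,
    gaussianBinomial_four_one hq, gaussianBinomial_three_one hq, (cast_choose_two_three_four _).1,
    (cast_choose_two_three_four _).2.1, Nat.choose_zero_right, Nat.choose_one_right, Nat.reduceSub] at e0 e1 e2 e3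
  push_cast at e0 e1 e2 e3
  have hq0 : (Fintype.card F : ℚ) ≠ 0 := by positivity
  have hq1 : (Fintype.card F : ℚ) + 1 ≠ 0 := by positivity
  have hq2 : 2 * (Fintype.card F : ℚ) + 1 ≠ 0 := by positivity
  generalize (Fintype.card F : ℚ) = q at *
  have h3 : (countSystems F 1 (2 * Fintype.card F + 1) : ℚ) =
      (q ^ 4 + 2 * q ^ 3 + 2 * q ^ 2 + q) / 2 := by
    apply mul_left_cancel₀ (mul_ne_zero hq2 (mul_ne_zero hq0 hq0))
    -- This combination of the second and third moments eliminates the conics with `q + 1` points.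
    linear_combination (6 * e3 + 2 * (1 - q) * e2) / 2
  have h2 : (countSystems F 1 (Fintype.card F + 1) : ℚ) = q ^ 5 + q + 1 := by
    apply mul_left_cancel₀ (mul_ne_zero hq1 hq0)
    linear_combination 2 * e2 - (2 * q + 1) * (2 * q) * h3
  have h1 : (countSystems F 1 1 : ℚ) = (q ^ 4 - q) / 2 := by
    linear_combination e1 - (q + 1) * h2 - (2 * q + 1) * h3
  have h0 : (countSystems F 1 0 : ℚ) = 0 := by
    linear_combination e0 - h1 - h2 - h3
  exact ⟨by exact_mod_cast h0, h1, h2, h3⟩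

/-- The two counts with a fixed line are known; moments 4 down to 0 then give the other five one at
a time. -/
theorem countSystems_two (hF : 4 ≤ Fintype.card F) :
    (countSystems F 2 (Fintype.card F + 2) : ℚ) =
      (Fintype.card F : ℚ) ^ 4 + (Fintype.card F : ℚ) ^ 3 + (Fintype.card F : ℚ) ^ 2 ∧
    (countSystems F 2 (Fintype.card F + 1) : ℚ) =
      (Fintype.card F : ℚ) ^ 3 + 2 * (Fintype.card F : ℚ) ^ 2 + 2 * (Fintype.card F : ℚ) + 1 ∧
    (countSystems F 2 4 : ℚ) = ((Fintype.card F : ℚ) ^ 8 - (Fintype.card F : ℚ) ^ 6 -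
      (Fintype.card F : ℚ) ^ 5 + (Fintype.card F : ℚ) ^ 3) / 24 ∧
    (countSystems F 2 3 : ℚ) = ((Fintype.card F : ℚ) ^ 7 + (Fintype.card F : ℚ) ^ 6 -
      (Fintype.card F : ℚ) ^ 4 - (Fintype.card F : ℚ) ^ 3) / 2 ∧
    (countSystems F 2 2 : ℚ) = ((Fintype.card F : ℚ) ^ 8 + 5 * (Fintype.card F : ℚ) ^ 6 +
      7 * (Fintype.card F : ℚ) ^ 5 + 4 * (Fintype.card F : ℚ) ^ 4 - (Fintype.card F : ℚ) ^ 3 -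
      4 * (Fintype.card F : ℚ) ^ 2) / 4 ∧
    (countSystems F 2 1 : ℚ) = (2 * (Fintype.card F : ℚ) ^ 8 + 3 * (Fintype.card F : ℚ) ^ 7 +
      (Fintype.card F : ℚ) ^ 6 + 4 * (Fintype.card F : ℚ) ^ 5 + 9 * (Fintype.card F : ℚ) ^ 4 +
      5 * (Fintype.card F : ℚ) ^ 3 - 6 * (Fintype.card F : ℚ)) / 6 ∧
    (countSystems F 2 0 : ℚ) = (3 * (Fintype.card F : ℚ) ^ 8 + (Fintype.card F : ℚ) ^ 6 -
      3 * (Fintype.card F : ℚ) ^ 5 - (Fintype.card F : ℚ) ^ 3) / 8 := by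
  have hm := fun j hj hr => sum_countSystems_mul_choose (F := F) (r := 2) (j := j) hj hr _
    fun D hD => card_zeros_of_finrank_eq_two hD
  have e0 := hm 0 (by norm_num) (by norm_num)
  have e1 := hm 1 (by norm_num) (by norm_num)
  have e2 := hm 2 (by norm_num) (by norm_num)
  have e3 := hm 3 (by norm_num) (by norm_num)
  clear hm
  have e4 := (sum_systemsIn_eq 2 _
    (fun D hD => card_zeros_of_finrank_eq_two (mem_systemsIn.1 hD).2)
    fun k => (k.choose 4 : ℚ)).symm.trans (sum_choose_four_card_zeros (F := F))
  have h6 := congrArg (Nat.cast : ℕ → ℚ)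
    (countSystems_two_line (F := F) hF card_filter_card_zeros_sdiff_eq_one)
  have h5 := congrArg (Nat.cast : ℕ → ℚ)
    (countSystems_two_line (F := F) hF card_filter_card_zeros_sdiff_eq_zero)
  have hq : (1 : ℚ) < Fintype.card F := by exact_mod_cast (by omega : 1 < Fintype.card F)
  -- The bound `4 ≤ q` keeps `q + 1` and `q + 2` distinct from 0, …, 4.
  rw [Finset.sum_insert (by simp; omega), Finset.sum_insert (by simp; omega),
    Finset.sum_insert (by simp), Finset.sum_insert (by simp), Finset.sum_insert (by simp),
    Finset.sum_insert (by simp), Finset.sum_singleton] at e0 e1 e2 e3 e4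
  simp only [gaussianBinomial_six_two hq, gaussianBinomial_five_two hq,
    gaussianBinomial_four_two hq, gaussianBinomial_three_two hq, gaussianBinomial_self hq,
    (cast_choose_two_three_four _).1, (cast_choose_two_three_four _).2.1,
    (cast_choose_two_three_four _).2.2, Nat.choose_zero_right, Nat.choose_one_right,
    Nat.reduceSub] at e0 e1 e2 e3 e4
  simp only [add_zero, add_assoc, Nat.reduceAdd] at h5 h6
  push_cast at e0 e1 e2 e3 e4 h5 h6
  generalize (Fintype.card F : ℚ) = q at *
  have h6' : (countSystems F 2 (Fintype.card F + 2) : ℚ) = q ^ 4 + q ^ 3 + q ^ 2 := by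
    linear_combination h6
  have h5' : (countSystems F 2 (Fintype.card F + 1) : ℚ) = q ^ 3 + 2 * q ^ 2 + 2 * q + 1 := by
    linear_combination h5
  have h4 : (countSystems F 2 4 : ℚ) = (q ^ 8 - q ^ 6 - q ^ 5 + q ^ 3) / 24 := by
    linear_combination e4 - (q + 2) * (q + 1) * q * (q - 1) / 24 * h6' -
      (q + 1) * q * (q - 1) * (q - 2) / 24 * h5'
  have h3 : (countSystems F 2 3 : ℚ) = (q ^ 7 + q ^ 6 - q ^ 4 - q ^ 3) / 2 := by
    linear_combination e3 - (q + 2) * (q + 1) * q / 6 * h6' - (q + 1) * q * (q - 1) / 6 * h5' -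
      4 * h4
  have h2 : (countSystems F 2 2 : ℚ) =
      (q ^ 8 + 5 * q ^ 6 + 7 * q ^ 5 + 4 * q ^ 4 - q ^ 3 - 4 * q ^ 2) / 4 := by
    linear_combination e2 - (q + 2) * (q + 1) / 2 * h6' - (q + 1) * q / 2 * h5' -
      6 * h4 - 3 * h3
  have h1 : (countSystems F 2 1 : ℚ) = (2 * q ^ 8 + 3 * q ^ 7 + q ^ 6 + 4 * q ^ 5 + 9 * q ^ 4 +
      5 * q ^ 3 - 6 * q) / 6 := by
    linear_combination e1 - (q + 2) * h6' - (q + 1) * h5' - 4 * h4 - 3 * h3 - 2 * h2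
  have h0 : (countSystems F 2 0 : ℚ) = (3 * q ^ 8 + q ^ 6 - 3 * q ^ 5 - q ^ 3) / 8 := by
    linear_combination e0 - h6' - h5' - h4 - h3 - h2 - h1
  exact ⟨h6', h5', h4, h3, h2, h1, h0⟩

theorem countSystems_three (hF : 4 ≤ Fintype.card F) :
    (countSystems F 3 (Fintype.card F + 1) : ℚ) =
      (Fintype.card F : ℚ) ^ 2 + Fintype.card F + 1 ∧
    (countSystems F 3 3 : ℚ) = ((Fintype.card F : ℚ) ^ 6 + 2 * (Fintype.card F : ℚ) ^ 5 +
      2 * (Fintype.card F : ℚ) ^ 4 + (Fintype.card F : ℚ) ^ 3) / 6 ∧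
    (countSystems F 3 2 : ℚ) = ((Fintype.card F : ℚ) ^ 7 + 2 * (Fintype.card F : ℚ) ^ 6 +
      3 * (Fintype.card F : ℚ) ^ 5 + 3 * (Fintype.card F : ℚ) ^ 4 +
      2 * (Fintype.card F : ℚ) ^ 3 + (Fintype.card F : ℚ) ^ 2) / 2 ∧
    (countSystems F 3 1 : ℚ) = (2 * (Fintype.card F : ℚ) ^ 8 + 2 * (Fintype.card F : ℚ) ^ 7 +
      3 * (Fintype.card F : ℚ) ^ 6 + 2 * (Fintype.card F : ℚ) ^ 5 +
      4 * (Fintype.card F : ℚ) ^ 4 + 3 * (Fintype.card F : ℚ) ^ 3 +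
      2 * (Fintype.card F : ℚ) ^ 2) / 2 ∧
    (countSystems F 3 0 : ℚ) = (6 * (Fintype.card F : ℚ) ^ 9 + 3 * (Fintype.card F : ℚ) ^ 7 +
      2 * (Fintype.card F : ℚ) ^ 6 + (Fintype.card F : ℚ) ^ 5 - 5 * (Fintype.card F : ℚ) ^ 4 +
      2 * (Fintype.card F : ℚ) ^ 3 - 3 * (Fintype.card F : ℚ) ^ 2) / 6 := by
  have hm := fun j hj hr => sum_countSystems_mul_choose (F := F) (r := 3) (j := j) hj hr _
    fun D hD => card_zeros_of_finrank_eq_three hD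
  have e0 := hm 0 (by norm_num) (by norm_num)
  have e1 := hm 1 (by norm_num) (by norm_num)
  have e2 := hm 2 (by norm_num) (by norm_num)
  have e3 := hm 3 (by norm_num) (by norm_num)
  clear hm
  have h4 := congrArg (Nat.cast : ℕ → ℚ) (countSystems_three_line (F := F) (by omega))
  have hq : (1 : ℚ) < Fintype.card F := by exact_mod_cast (by omega : 1 < Fintype.card F)
  rw [Finset.sum_insert (by simp; omega), Finset.sum_insert (by simp),
    Finset.sum_insert (by simp), Finset.sum_insert (by simp), Finset.sum_singleton] at e0 e1 e2 e3
  simp only [gaussianBinomial_six_three hq, gaussianBinomial_five_three hq,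
    gaussianBinomial_four_three hq, gaussianBinomial_self hq,
    (cast_choose_two_three_four _).1, (cast_choose_two_three_four _).2.1,
    Nat.choose_zero_right, Nat.choose_one_right, Nat.reduceSub] at e0 e1 e2 e3
  push_cast at e0 e1 e2 e3 h4
  generalize (Fintype.card F : ℚ) = q at *
  have h3 : (countSystems F 3 3 : ℚ) = (q ^ 6 + 2 * q ^ 5 + 2 * q ^ 4 + q ^ 3) / 6 := by
    linear_combination e3 - (q + 1) * q * (q - 1) / 6 * h4
  have h2 : (countSystems F 3 2 : ℚ) =
      (q ^ 7 + 2 * q ^ 6 + 3 * q ^ 5 + 3 * q ^ 4 + 2 * q ^ 3 + q ^ 2) / 2 := by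
    linear_combination e2 - (q + 1) * q / 2 * h4 - 3 * h3
  have h1 : (countSystems F 3 1 : ℚ) =
      (2 * q ^ 8 + 2 * q ^ 7 + 3 * q ^ 6 + 2 * q ^ 5 + 4 * q ^ 4 + 3 * q ^ 3 + 2 * q ^ 2) / 2 := by
    linear_combination e1 - (q + 1) * h4 - 3 * h3 - 2 * h2
  have h0 : (countSystems F 3 0 : ℚ) = (6 * q ^ 9 + 3 * q ^ 7 + 2 * q ^ 6 + q ^ 5 - 5 * q ^ 4 +
      2 * q ^ 3 - 3 * q ^ 2) / 6 := by
    linear_combination e0 - h4 - h3 - h2 - h1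
  exact ⟨h4, h3, h2, h1, h0⟩

theorem countSystems_four :
    (countSystems F 4 2 : ℚ) = ((Fintype.card F : ℚ) ^ 4 + 2 * (Fintype.card F : ℚ) ^ 3 +
      2 * (Fintype.card F : ℚ) ^ 2 + Fintype.card F) / 2 ∧
    (countSystems F 4 1 : ℚ) = (Fintype.card F : ℚ) ^ 6 + 2 * (Fintype.card F : ℚ) ^ 5 +
      2 * (Fintype.card F : ℚ) ^ 4 + (Fintype.card F : ℚ) ^ 3 + (Fintype.card F : ℚ) ^ 2 +
      Fintype.card F + 1 ∧
    (countSystems F 4 0 : ℚ) = (2 * (Fintype.card F : ℚ) ^ 8 + 2 * (Fintype.card F : ℚ) ^ 7 +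
      2 * (Fintype.card F : ℚ) ^ 6 + (Fintype.card F : ℚ) ^ 4 - Fintype.card F) / 2 := by
  have hm := fun j hj hr => sum_countSystems_mul_choose (F := F) (r := 4) (j := j) hj hr
    (Finset.range 3) fun D hD => by
      have := card_zeros_add_finrank_le_six (D := D) hD.ge
      rw [Finset.mem_range]
      omega
  have e0 := hm 0 (by norm_num) (by norm_num)
  have e1 := hm 1 (by norm_num) (by norm_num)
  have e2 := hm 2 (by norm_num) (by norm_num)
  clear hm
  have hq : (1 : ℚ) < Fintype.card F := by exact_mod_cast Fintype.one_lt_card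
  simp only [gaussianBinomial_six_four hq, gaussianBinomial_five_four hq, gaussianBinomial_self hq,
    (cast_choose_two_three_four _).1, Finset.sum_range_succ, Finset.sum_range_zero,
    Nat.choose_zero_right, Nat.choose_one_right, Nat.reduceSub] at e0 e1 e2
  push_cast at e0 e1 e2
  generalize (Fintype.card F : ℚ) = q at *
  have h2 : (countSystems F 4 2 : ℚ) = (q ^ 4 + 2 * q ^ 3 + 2 * q ^ 2 + q) / 2 := by
    linear_combination e2
  have h1 : (countSystems F 4 1 : ℚ) =
      q ^ 6 + 2 * q ^ 5 + 2 * q ^ 4 + q ^ 3 + q ^ 2 + q + 1 := by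
    linear_combination e1 - 2 * h2
  have h0 : (countSystems F 4 0 : ℚ) =
      (2 * q ^ 8 + 2 * q ^ 7 + 2 * q ^ 6 + q ^ 4 - q) / 2 := by
    linear_combination e0 - h2 - h1
  exact ⟨h2, h1, h0⟩

theorem countSystems_five :
    (countSystems F 5 1 : ℚ) = (Fintype.card F : ℚ) ^ 2 + Fintype.card F + 1 ∧
    (countSystems F 5 0 : ℚ) = (Fintype.card F : ℚ) ^ 5 + (Fintype.card F : ℚ) ^ 4 +
      (Fintype.card F : ℚ) ^ 3 := by
  have hm := fun j hj hr => sum_countSystems_mul_choose (F := F) (r := 5) (j := j) hj hr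
    (Finset.range 2) fun D hD => by
      have := card_zeros_add_finrank_le_six (D := D) (by omega)
      rw [Finset.mem_range]
      omega
  have e0 := hm 0 (by norm_num) (by norm_num)
  have e1 := hm 1 (by norm_num) (by norm_num)
  clear hm
  have hq : (1 : ℚ) < Fintype.card F := by exact_mod_cast Fintype.one_lt_card
  simp only [gaussianBinomial_six_five hq, gaussianBinomial_self hq, Finset.sum_range_succ,
    Finset.sum_range_zero, Nat.choose_zero_right, Nat.choose_one_right, Nat.reduceSub] at e0 e1
  push_cast at e0 e1
  generalize (Fintype.card F : ℚ) = q at *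
  have h1 : (countSystems F 5 1 : ℚ) = q ^ 2 + q + 1 := by linear_combination e1
  exact ⟨h1, by linear_combination e0 - h1⟩

theorem countSystems_six : (countSystems F 6 0 : ℚ) = 1 := by
  have e0 := sum_countSystems_mul_choose (F := F) (r := 6) (j := 0) (by norm_num) (by norm_num)
    {0} fun D hD => by
      have := card_zeros_add_finrank_le_six (D := D) (by omega)
      rw [Finset.mem_singleton]
      omega
  have hq : (1 : ℚ) < Fintype.card F := by exact_mod_cast Fintype.one_lt_card
  simpa [gaussianBinomial_self hq] using e0

end Spectrum

end Veronese

namespace Veronese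

open Configuration Configuration.ofField Matrix

/-! ### From linear systems of conics to subcodes. -/

section Code

variable {F : Type*} [Field F]

theorem veroneseMap_eq (P : Plane F) :
    veroneseMap P = Projectivization.mk F (monomials P.rep) (monomials_ne_zero P.rep_nonzero) := by
  conv_lhs => rw [← P.mk_rep]
  rfl

/-- The square of a line through `Q` missing `P` is a quadratic form that separates the images. -/
theorem veroneseMap_injective : Function.Injective (veroneseMap (F := F)) := by
  intro P Q h
  by_contra hPQ
  obtain ⟨l, hQ, hP⟩ := exists_line_notMem (Ne.symm hPQ)
  rw [veroneseMap_eq, veroneseMap_eq, Projectivization.mk_eq_mk_iff'] at h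
  obtain ⟨a, ha⟩ := h
  rw [mem_iff_dotProduct] at hP hQ
  have h1 := mulForm_dotProduct_monomials l.rep l.rep P.rep
  rw [← ha, dotProduct_smul, mulForm_dotProduct_monomials, hQ] at h1
  exact mul_ne_zero hP hP (by rw [← h1]; simp)

/-- The columns of a generator matrix of the Veronese code correspond to the points of the
plane. -/
theorem exists_equiv_plane {n : ℕ} {G : Matrix (Fin 6) (Fin n) F} (hG : IsVeroneseMatrix G) :
    ∃ e : Fin n ≃ Plane F, ∀ j, ∃ a : F, a ≠ 0 ∧ G.col j = a • monomials (e j).rep := by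
  obtain ⟨h0, hinj, hrange⟩ := hG
  have hex : ∀ j, ∃ P : Plane F, veroneseMap P = Projectivization.mk F (G.col j) (h0 j) :=
    fun j => hrange.subset ⟨j, rfl⟩
  choose p hp using hex
  refine ⟨Equiv.ofBijective p ⟨fun i j hij => hinj ?_, fun P => ?_⟩, fun j => ?_⟩
  · change Projectivization.mk F (G.col i) (h0 i) = Projectivization.mk F (G.col j) (h0 j)
    rw [← hp, ← hp, hij]
  · obtain ⟨j, hj⟩ := hrange.superset ⟨P, rfl⟩
    exact ⟨j, veroneseMap_injective ((hp j).trans hj)⟩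
  · have h := hp j
    rw [veroneseMap_eq, eq_comm, Projectivization.mk_eq_mk_iff'] at h
    obtain ⟨a, ha⟩ := h
    refine ⟨a, fun h => h0 j ?_, ha.symm⟩
    rw [← ha, h, zero_smul]

variable {n : ℕ} {G : Matrix (Fin 6) (Fin n) F}

theorem vecMul_apply_eq_zero_iff {c : Fin 6 → F} {j : Fin n} {P : Plane F} {a : F}
    (ha : a ≠ 0) (h : G.col j = a • monomials P.rep) :
    (c ᵥ* G) j = 0 ↔ c ⬝ᵥ monomials P.rep = 0 := by
  have : (c ᵥ* G) j = c ⬝ᵥ G.col j := rfl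
  rw [this, h, dotProduct_smul, smul_eq_mul, mul_eq_zero, or_iff_right ha]

theorem rowCode_eq_range : rowCode G = LinearMap.range G.vecMulLinear :=
  (range_vecMulLinear G).symm

variable [Fintype (Plane F)]

/-- A position is outside the support exactly when its point is a common zero; the choice of column
representatives does not matter. -/
theorem codeWeight_add_card_zeros (hG : IsVeroneseMatrix G) (D : Submodule F (Fin 6 → F)) :
    codeWeight (D.map G.vecMulLinear : Set (Fin n → F)) + (zeros D).card =
      Fintype.card (Plane F) := by
  classical
  obtain ⟨e, he⟩ := exists_equiv_plane hG
  have hsupp : e '' codeSupport (D.map G.vecMulLinear : Set (Fin n → F)) =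
      ((zeros D)ᶜ : Finset (Plane F)) := by
    ext P
    obtain ⟨j, rfl⟩ := e.surjective P
    obtain ⟨a, ha, h⟩ := he j
    rw [e.injective.mem_set_image]
    simp [codeSupport, mem_zeros, vecMul_apply_eq_zero_iff ha h]
  rw [codeWeight, ← Set.ncard_image_of_injective _ e.injective, hsupp, Set.ncard_coe_finset,
    Finset.card_compl_add_card]

/-- A nonzero form has at most `2 q + 1 < q ^ 2 + q + 1` zeros, so it cannot vanish on the whole
plane. -/
theorem vecMulLinear_injective [Fintype F] (hG : IsVeroneseMatrix G) :
    Function.Injective G.vecMulLinear := by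
  rw [injective_iff_map_eq_zero]
  intro c hc
  by_contra hc0
  obtain ⟨e, he⟩ := exists_equiv_plane hG
  have hz : zeros (Submodule.span F {c}) = Finset.univ := by
    refine Finset.eq_univ_of_forall fun P => mem_zeros_span.2 ?_
    obtain ⟨j, rfl⟩ := e.surjective P
    obtain ⟨a, ha, h⟩ := he j
    exact (vecMul_apply_eq_zero_iff ha h).1 (congrFun hc j)
  have h := card_zeros_of_finrank_eq_one (finrank_span_singleton (K := F) hc0)
  rw [hz, Finset.card_univ, card_plane] at h
  simp only [Finset.mem_insert, Finset.mem_singleton] at h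
  have := Fintype.one_lt_card (α := F)
  have : Fintype.card F < Fintype.card F ^ 2 := by nlinarith
  omega

/-- The subcodes of the Veronese code are the images of the linear systems of conics. -/
theorem setOf_subcodes_eq_image [Fintype F] (hG : IsVeroneseMatrix G) (r w : ℕ) :
    {D : Submodule F (Fin n → F) |
      D ≤ rowCode G ∧ Module.finrank F D = r ∧ codeWeight (D : Set (Fin n → F)) = w} =
    Submodule.map G.vecMulLinear '' {D : Submodule F (Fin 6 → F) |
      Module.finrank F D = r ∧ w + (zeros D).card = Fintype.card F ^ 2 + Fintype.card F + 1} := by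
  have hinj := vecMulLinear_injective hG
  have hfin : ∀ D : Submodule F (Fin 6 → F),
      Module.finrank F (D.map G.vecMulLinear) = Module.finrank F D := fun D =>
    (Submodule.equivMapOfInjective G.vecMulLinear hinj D).finrank_eq.symm
  rw [← card_plane]
  ext E
  constructor
  · rintro ⟨hE, hr, hw⟩
    rw [rowCode_eq_range] at hE
    obtain ⟨D, rfl⟩ : ∃ D, Submodule.map G.vecMulLinear D = E :=
      ⟨E.comap G.vecMulLinear, by rw [Submodule.map_comap_eq, inf_eq_right.2 hE]⟩
    refine ⟨D, ⟨(hfin D).symm.trans hr, ?_⟩, rfl⟩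
    rw [← hw, codeWeight_add_card_zeros hG]
  · rintro ⟨D, ⟨hr, hw⟩, rfl⟩
    refine ⟨rowCode_eq_range (G := G) ▸ LinearMap.map_le_range, (hfin D).trans hr, ?_⟩
    have := codeWeight_add_card_zeros hG D
    omega

theorem higherWeight_rowCode [Fintype F] [Fintype (Submodule F (Fin 6 → F))]
    (hG : IsVeroneseMatrix G) {r w k : ℕ}
    (hk : w + k = Fintype.card F ^ 2 + Fintype.card F + 1) :
    higherWeight (rowCode G) r w = countSystems F r k := by
  classical
  rw [higherWeight, setOf_subcodes_eq_image hG, Set.ncard_image_of_injective _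
    (Submodule.map_injective_of_injective (vecMulLinear_injective hG)), countSystems,
    ← Set.ncard_coe_finset]
  congr 1
  ext D
  simp only [Set.mem_ofPred_eq, Finset.coe_filter, mem_systemsIn, le_top, true_and]
  refine and_congr_right fun _ => ?_
  omega

theorem exists_system_of_higherWeight_ne_zero [Fintype F] (hG : IsVeroneseMatrix G) {r w : ℕ}
    (h : higherWeight (rowCode G) r w ≠ 0) :
    ∃ D : Submodule F (Fin 6 → F), Module.finrank F D = r ∧
      w + (zeros D).card = Fintype.card F ^ 2 + Fintype.card F + 1 := by
  obtain ⟨_, hE⟩ := Set.nonempty_of_ncard_ne_zero h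
  rw [setOf_subcodes_eq_image hG] at hE
  obtain ⟨D, hD, -⟩ := hE
  exact ⟨D, hD⟩

theorem mem_exceptionalPairs_of_higherWeight_ne_zero [Fintype F] (hF : 4 ≤ Fintype.card F)
    (hG : IsVeroneseMatrix G) {r w : ℕ} (hr : 1 ≤ r) (h : higherWeight (rowCode G) r w ≠ 0) :
    (r, w) ∈ exceptionalPairs (Fintype.card F) := by
  have : Fintype (Submodule F (Fin 6 → F)) := Fintype.ofFinite _
  obtain ⟨D, hD, hw⟩ := exists_system_of_higherWeight_ne_zero hG h
  have hsq : 4 * Fintype.card F ≤ Fintype.card F ^ 2 := by nlinarith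
  have h6 : r ≤ 6 := by simpa [hD] using Submodule.finrank_le D
  obtain rfl | rfl | rfl | hr4 : r = 1 ∨ r = 2 ∨ r = 3 ∨ 4 ≤ r := by omega
  · have hz := card_zeros_of_finrank_eq_one hD
    -- The value 0, allowed by the classification of conics, is excluded by the computed count.
    have h0 : (zeros D).card ≠ 0 := fun h0 => by
      rw [h0] at hw
      exact h ((higherWeight_rowCode hG hw).trans countSystems_one.1)
    simp only [Finset.mem_insert, Finset.mem_singleton] at hz
    have : w = Fintype.card F ^ 2 - Fintype.card F ∨ w = Fintype.card F ^ 2 ∨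
        w = Fintype.card F ^ 2 + Fintype.card F := by omega
    rcases this with rfl | rfl | rfl <;> simp [exceptionalPairs]
  · have hz := card_zeros_of_finrank_eq_two hD
    simp only [Finset.mem_insert, Finset.mem_singleton] at hz
    have : w = Fintype.card F ^ 2 - 1 ∨ w = Fintype.card F ^ 2 ∨
        w = Fintype.card F ^ 2 + Fintype.card F - 3 ∨
        w = Fintype.card F ^ 2 + Fintype.card F - 2 ∨
        w = Fintype.card F ^ 2 + Fintype.card F - 1 ∨
        w = Fintype.card F ^ 2 + Fintype.card F ∨
        w = Fintype.card F ^ 2 + Fintype.card F + 1 := by omega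
    rcases this with rfl | rfl | rfl | rfl | rfl | rfl | rfl <;> simp [exceptionalPairs]
  · have hz := card_zeros_of_finrank_eq_three hD
    simp only [Finset.mem_insert, Finset.mem_singleton] at hz
    have : w = Fintype.card F ^ 2 ∨ w = Fintype.card F ^ 2 + Fintype.card F - 2 ∨
        w = Fintype.card F ^ 2 + Fintype.card F - 1 ∨
        w = Fintype.card F ^ 2 + Fintype.card F ∨
        w = Fintype.card F ^ 2 + Fintype.card F + 1 := by omega
    rcases this with rfl | rfl | rfl | rfl | rfl <;> simp [exceptionalPairs]
  · have hz := card_zeros_add_finrank_le_six (D := D) (by omega)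
    have : (r = 4 ∧ w = Fintype.card F ^ 2 + Fintype.card F - 1) ∨
        ((r = 4 ∨ r = 5) ∧ w = Fintype.card F ^ 2 + Fintype.card F) ∨
        ((r = 4 ∨ r = 5 ∨ r = 6) ∧ w = Fintype.card F ^ 2 + Fintype.card F + 1) := by omega
    rcases this with ⟨rfl, rfl⟩ | ⟨rfl | rfl, rfl⟩ | ⟨rfl | rfl | rfl, rfl⟩ <;>
      simp [exceptionalPairs]

end Code

end Veronese

/-! ### The weight spectrum, read off with `k = q ^ 2 + q + 1 - w`. -/

theorem theorem3p1 {F : Type*} [Field F] [Fintype F] (q : ℕ) (hq : Fintype.card F = q)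
    (hq4 : 4 ≤ q) {n : ℕ} (G : Matrix (Fin 6) (Fin n) F) (hG : Veronese.IsVeroneseMatrix G)
    (C : Submodule F (Fin n → F)) (hC : C = Veronese.rowCode G)
    (A : ℕ → ℕ → ℕ) (hA : A = Veronese.higherWeight C) :
    n = q ^ 2 + q + 1 ∧ Module.finrank F C = 6 ∧
    (A 1 (q ^ 2 - q) : ℚ) = ((q : ℚ) ^ 4 + 2 * q ^ 3 + 2 * q ^ 2 + q) / 2 ∧
    (A 1 (q ^ 2) : ℚ) = (q : ℚ) ^ 5 + q + 1 ∧
    (A 1 (q ^ 2 + q) : ℚ) = ((q : ℚ) ^ 4 - q) / 2 ∧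
    (A 2 (q ^ 2 - 1) : ℚ) = (q : ℚ) ^ 4 + q ^ 3 + q ^ 2 ∧
    (A 2 (q ^ 2) : ℚ) = (q : ℚ) ^ 3 + 2 * q ^ 2 + 2 * q + 1 ∧
    (A 2 (q ^ 2 + q - 3) : ℚ) = ((q : ℚ) ^ 8 - q ^ 6 - q ^ 5 + q ^ 3) / 24 ∧
    (A 2 (q ^ 2 + q - 2) : ℚ) = ((q : ℚ) ^ 7 + q ^ 6 - q ^ 4 - q ^ 3) / 2 ∧
    (A 2 (q ^ 2 + q - 1) : ℚ) =
      ((q : ℚ) ^ 8 + 5 * q ^ 6 + 7 * q ^ 5 + 4 * q ^ 4 - q ^ 3 - 4 * q ^ 2) / 4 ∧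
    (A 2 (q ^ 2 + q) : ℚ) =
      (2 * (q : ℚ) ^ 8 + 3 * q ^ 7 + q ^ 6 + 4 * q ^ 5 + 9 * q ^ 4 + 5 * q ^ 3 - 6 * q) / 6 ∧
    (A 2 (q ^ 2 + q + 1) : ℚ) = (3 * (q : ℚ) ^ 8 + q ^ 6 - 3 * q ^ 5 - q ^ 3) / 8 ∧
    (A 3 (q ^ 2) : ℚ) = (q : ℚ) ^ 2 + q + 1 ∧
    (A 3 (q ^ 2 + q - 2) : ℚ) = ((q : ℚ) ^ 6 + 2 * q ^ 5 + 2 * q ^ 4 + q ^ 3) / 6 ∧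
    (A 3 (q ^ 2 + q - 1) : ℚ) =
      ((q : ℚ) ^ 7 + 2 * q ^ 6 + 3 * q ^ 5 + 3 * q ^ 4 + 2 * q ^ 3 + q ^ 2) / 2 ∧
    (A 3 (q ^ 2 + q) : ℚ) =
      (2 * (q : ℚ) ^ 8 + 2 * q ^ 7 + 3 * q ^ 6 + 2 * q ^ 5 + 4 * q ^ 4 + 3 * q ^ 3
        + 2 * q ^ 2) / 2 ∧
    (A 3 (q ^ 2 + q + 1) : ℚ) =
      (6 * (q : ℚ) ^ 9 + 3 * q ^ 7 + 2 * q ^ 6 + q ^ 5 - 5 * q ^ 4 + 2 * q ^ 3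
        - 3 * q ^ 2) / 6 ∧
    (A 4 (q ^ 2 + q - 1) : ℚ) = ((q : ℚ) ^ 4 + 2 * q ^ 3 + 2 * q ^ 2 + q) / 2 ∧
    (A 4 (q ^ 2 + q) : ℚ) = (q : ℚ) ^ 6 + 2 * q ^ 5 + 2 * q ^ 4 + q ^ 3 + q ^ 2 + q + 1 ∧
    (A 4 (q ^ 2 + q + 1) : ℚ) = (2 * (q : ℚ) ^ 8 + 2 * q ^ 7 + 2 * q ^ 6 + q ^ 4 - q) / 2 ∧
    (A 5 (q ^ 2 + q) : ℚ) = (q : ℚ) ^ 2 + q + 1 ∧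
    (A 5 (q ^ 2 + q + 1) : ℚ) = (q : ℚ) ^ 5 + q ^ 4 + q ^ 3 ∧
    (A 6 (q ^ 2 + q + 1) : ℚ) = 1 ∧
    (∀ r w : ℕ, 1 ≤ r → (r, w) ∉ Veronese.exceptionalPairs q → A r w = 0) := by
  subst hC hA hq
  have : Fintype (Veronese.Plane F) := Fintype.ofFinite _
  have : Fintype (Submodule F (Fin 6 → F)) := Fintype.ofFinite _
  -- With this linear bound on `q ^ 2`, `omega` sees that none of the natural-number subtractions
  -- truncates.
  have hsq : 4 * Fintype.card F ≤ Fintype.card F ^ 2 := by nlinarith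
  have hA : ∀ {r w : ℕ} (k : ℕ), w + k = Fintype.card F ^ 2 + Fintype.card F + 1 →
      Veronese.higherWeight (Veronese.rowCode G) r w = Veronese.countSystems F r k :=
    fun k hk => Veronese.higherWeight_rowCode hG hk
  obtain ⟨-, a11, a12, a13⟩ := Veronese.countSystems_one (F := F)
  obtain ⟨a21, a22, a23, a24, a25, a26, a27⟩ := Veronese.countSystems_two hq4
  obtain ⟨a31, a32, a33, a34, a35⟩ := Veronese.countSystems_three hq4
  obtain ⟨a41, a42, a43⟩ := Veronese.countSystems_four (F := F)
  obtain ⟨a51, a52⟩ := Veronese.countSystems_five (F := F)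
  refine ⟨?_, ?_, ?_, ?_, ?_, ?_, ?_, ?_, ?_, ?_, ?_, ?_, ?_, ?_, ?_, ?_, ?_, ?_, ?_, ?_, ?_, ?_,
    ?_, fun r w hr hrw => ?_⟩
  · obtain ⟨e, -⟩ := Veronese.exists_equiv_plane hG
    rw [← Veronese.card_plane, ← Fintype.card_congr e, Fintype.card_fin]
  · rw [Veronese.rowCode_eq_range,
      LinearMap.finrank_range_of_inj (Veronese.vecMulLinear_injective hG)]
    simp
  · rw [hA (2 * Fintype.card F + 1) (by omega), a13]
  · rw [hA (Fintype.card F + 1) (by omega), a12]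
  · rw [hA 1 (by omega), a11]
  · rw [hA (Fintype.card F + 2) (by omega), a21]
  · rw [hA (Fintype.card F + 1) (by omega), a22]
  · rw [hA 4 (by omega), a23]
  · rw [hA 3 (by omega), a24]
  · rw [hA 2 (by omega), a25]
  · rw [hA 1 (by omega), a26]
  · rw [hA 0 (by omega), a27]
  · rw [hA (Fintype.card F + 1) (by omega), a31]
  · rw [hA 3 (by omega), a32]
  · rw [hA 2 (by omega), a33]
  · rw [hA 1 (by omega), a34]
  · rw [hA 0 (by omega), a35]
  · rw [hA 2 (by omega), a41]
  · rw [hA 1 (by omega), a42]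
  · rw [hA 0 (by omega), a43]
  · rw [hA 1 (by omega), a51]
  · rw [hA 0 (by omega), a52]
  · rw [hA 0 (by omega), Veronese.countSystems_six]
  · by_contra h
    exact hrw (Veronese.mem_exceptionalPairs_of_higherWeight_ne_zero hq4 hG hr h)
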